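/- A \emph{planar diagram} of a finite lattice $L$ represents the elements of $L$ by distinct points of the plane, larger elements being placed higher, and each covering $a\prec b$ by the straight line segment from $a$ to $b$, in such a way that no element lies in the interior of a segment and two different segments meet at most in a common endpoint. A \emph{left} (\emph{right}) \emph{corner} is a doubly irreducible element of $L\setminus\{0,1\}$ on the left (right) boundary of the diagram, that is, such that no point of the diagram at the same height is further to the left (right). A \emph{rectangular lattice} is a finite semimodular lattice that has a planar diagram with exactly one left corner $u_l$ and exactly one right corner $u_r$, and with $u_l\vee u_r=1$ and $u_l\wedge u_r=0$. Theorem. Let $D$ be a finite distributive lattice with at least two elements. Then there is a rectangular lattice $K$ such that $D$ is isomorphic to the congruence lattice $\operatorname{Con} K$ of $K$. -/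

import Mathlib

/-! ### The congruence lattice of a lattice -/

namespace LatticeCon

variable {L : Type*} [Lattice L]

theorem toSetoid_injective :
    Function.Injective (LatticeCon.toSetoid : LatticeCon L → Setoid L) := by
  intro c d h
  cases c
  cases d
  cases h
  rfl

/-- Congruences are ordered by inclusion: `c ≤ d` iff `c` relates `x` and `y` only if `d` does. -/
instance : PartialOrder (LatticeCon L) :=
  PartialOrder.lift LatticeCon.toSetoid toSetoid_injective

/-- The meet of a set of congruences is their intersection. -/
instance : InfSet (LatticeCon L) where
  sInf S :=
    { r := fun x y => ∀ c ∈ S, c.r x y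
      iseqv :=
        { refl := fun x c _ => c.refl x
          symm := fun h c hc => c.symm (h c hc)
          trans := fun h k c hc => c.trans (h c hc) (k c hc) }
      inf := fun h k c hc => c.inf (h c hc) (k c hc)
      sup := fun h k c hc => c.sup (h c hc) (k c hc) }

/-- The congruence lattice `Con L`. -/
instance : CompleteLattice (LatticeCon L) :=
  completeLatticeOfInf (LatticeCon L) fun _ =>
    ⟨fun c hc _ _ h => h c hc, fun _ hb _ _ h _ hc => hb hc h⟩

end LatticeCon

/-! ### Planar diagrams -/

/-- A planar diagram of a lattice: the elements are distinct points of the plane, larger elements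
are placed higher, each covering `a ⋖ b` is drawn as the straight line segment from `a` to `b`, no
element lies in the interior of a segment, and two different segments can only meet in the point
of a common endpoint. -/
structure PlanarDiagram (L : Type*) [Lattice L] where
  /-- the point of the plane that represents an element -/
  pos : L → ℝ × ℝ
  pos_injective : Function.Injective pos
  height_strictMono : StrictMono fun a => (pos a).2
  eq_of_mem_edge : ∀ {a b c : L}, a ⋖ b → pos c ∈ segment ℝ (pos a) (pos b) → c = a ∨ c = b
  edges_meet : ∀ {a b c d : L}, a ⋖ b → c ⋖ d → (a, b) ≠ (c, d) →
    ∀ p ∈ segment ℝ (pos a) (pos b) ∩ segment ℝ (pos c) (pos d),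
      ∃ x, (x = a ∨ x = b) ∧ (x = c ∨ x = d) ∧ p = pos x

namespace PlanarDiagram

variable {L : Type*} [Lattice L] (d : PlanarDiagram L)

/-- The subset of the plane that is drawn: all points of elements and all edges. -/
def support : Set (ℝ × ℝ) :=
  Set.range d.pos ∪ {p | ∃ a b : L, a ⋖ b ∧ p ∈ segment ℝ (d.pos a) (d.pos b)}

/-- The elements on the left boundary: no drawn point of the same height is further to the left. -/
def leftBoundary : Set L :=
  {x | ∀ p ∈ d.support, p.2 = (d.pos x).2 → (d.pos x).1 ≤ p.1}

/-- The elements on the right boundary: no drawn point of the same height is further to the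
right. -/
def rightBoundary : Set L :=
  {x | ∀ p ∈ d.support, p.2 = (d.pos x).2 → p.1 ≤ (d.pos x).1}

/-- A left corner: a doubly irreducible element, other than `0` and `1`, on the left boundary.
(`SupIrred` excludes `0` and `InfIrred` excludes `1`.) -/
def IsLeftCorner (x : L) : Prop :=
  SupIrred x ∧ InfIrred x ∧ x ∈ d.leftBoundary

/-- A right corner: a doubly irreducible element, other than `0` and `1`, on the right boundary. -/
def IsRightCorner (x : L) : Prop :=
  SupIrred x ∧ InfIrred x ∧ x ∈ d.rightBoundary

end PlanarDiagram

/-- A rectangular lattice: a finite (upper) semimodular lattice with a planar diagram in which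
there is exactly one left corner `ul` and exactly one right corner `ur`, and these two are
complements. -/
def IsRectangularLattice (L : Type*) [Lattice L] [BoundedOrder L] : Prop :=
  Finite L ∧ IsUpperModularLattice L ∧
    ∃ (d : PlanarDiagram L) (ul ur : L),
      (∀ x, d.IsLeftCorner x ↔ x = ul) ∧ (∀ x, d.IsRightCorner x ↔ x = ur) ∧ IsCompl ul ur

/-! ### Planar diagrams from order embeddings into the plane -/

/-! By Birkhoff's theorem `D` is the lattice of lower sets of the poset `P` of its join-irreducible
elements, so it suffices to realise `LowerSet P` as a congruence lattice.

Take a square grid. Its congruences are given by the unit intervals ("lines") that they collapse on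
the two lower sides, and without further structure these can be chosen independently. Colour the
lines by `P` and couple them by two devices. An eye is a third atom in a cell whose two lines have
the same colour. It completes the cell to an `M₃`, so both lines are collapsed together. As every
colour occurs on a free line, this couples all lines of one colour, on both sides
(`r_base_iff_of_color_eq`). A fork at `(f, f)` removes the points `(f, y)` and `(x, f)` with `x, y >
f`. Joins that would land there jump to `f + 1`, so that collapsing line `f - 1` collapses line `f`
(`r_base_of_fork`). Every pair `p ≤ q` is realised by a fork, hence the collapsed colours form a
lower set. Conversely, every lower set of colours defines a congruence of the grid (`Linked.shift`)
that extends to the eyes (`extendCon`). These two assignments are inverse to each other.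

Forks and eyes preserve semimodularity. The lattice embeds as an ordered set into the plane with the
product order, and such an embedding, turned by 45 degrees, is a planar diagram. The only doubly
irreducible grid points are the two side corners, and no eye lies on the boundary. -/

theorem OrderEmbedding.covBy_right_unique_of_mem_segments {L : Type*} [PartialOrder L]
    (φ : L ↪o ℝ × ℝ) {a b d : L} (hb : a ⋖ b) (hd : a ⋖ d) (hne : b ≠ d) {q : ℝ × ℝ}
    (h₁ : q ∈ segment ℝ (φ a) (φ b)) (h₂ : q ∈ segment ℝ (φ a) (φ d)) : q = φ a := by
  rw [segment_eq_image'] at h₁ h₂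
  obtain ⟨s, ⟨hs0, -⟩, hs⟩ := h₁
  obtain ⟨r, ⟨hr0, -⟩, hr⟩ := h₂
  simp only at hs hr
  by_contra hq
  have hs' : 0 < s := hs0.lt_of_ne (by rintro rfl; simp at hs; exact hq hs.symm)
  have hr' : 0 < r := hr0.lt_of_ne (by rintro rfl; simp at hr; exact hq hr.symm)
  -- Away from `φ a` the two segments would run along the same ray, which makes `φ b` and `φ d`
  -- comparable; two different covers of `a` are not.
  have e : s • (φ b - φ a) = r • (φ d - φ a) := by
    rw [← hr] at hs
    exact add_left_cancel hs
  have hb' := φ.monotone hb.le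
  have hd' := φ.monotone hd.le
  have e1 : s * ((φ b).1 - (φ a).1) = r * ((φ d).1 - (φ a).1) := congrArg Prod.fst e
  have e2 : s * ((φ b).2 - (φ a).2) = r * ((φ d).2 - (φ a).2) := congrArg Prod.snd e
  have hb1 := hb'.1
  have hb2 := hb'.2
  have hd1 := hd'.1
  have hd2 := hd'.2
  have key : ∀ {s r u v : ℝ}, 0 < r → s ≤ r → 0 ≤ u → s * u = r * v → v ≤ u := by
    intro s r u v hr hsr hu h
    by_contra! hlt
    nlinarith
  rcases le_total s r with h | h
  · have : φ d ≤ φ b :=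
      ⟨by have := key hr' h (sub_nonneg.2 hb1) e1; linarith,
        by have := key hr' h (sub_nonneg.2 hb2) e2; linarith⟩
    have hdb : d ≤ b := φ.le_iff_le.1 this
    exact hne ((hb.eq_or_eq hd.le hdb).resolve_left hd.lt.ne').symm
  · have : φ b ≤ φ d :=
      ⟨by have := key hs' h (sub_nonneg.2 hd1) e1.symm; linarith,
        by have := key hs' h (sub_nonneg.2 hd2) e2.symm; linarith⟩
    have hbd : b ≤ d := φ.le_iff_le.1 this
    exact hne ((hd.eq_or_eq hb.le hbd).resolve_left hb.lt.ne')

theorem OrderEmbedding.covBy_left_unique_of_mem_segments {L : Type*} [PartialOrder L]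
    (φ : L ↪o ℝ × ℝ) {a b c : L} (ha : a ⋖ b) (hc : c ⋖ b) (hne : a ≠ c) {q : ℝ × ℝ}
    (h₁ : q ∈ segment ℝ (φ a) (φ b)) (h₂ : q ∈ segment ℝ (φ c) (φ b)) : q = φ b := by
  -- The point reflection `-φ` embeds the dual order.
  let ψ : Lᵒᵈ ↪o ℝ × ℝ :=
    { toFun := fun x => -φ (OrderDual.ofDual x)
      inj' := fun x y h => φ.injective (neg_injective h)
      map_rel_iff' := by
        intro x y
        exact neg_le_neg_iff.trans φ.le_iff_le }
  have hneg : ∀ {u v : ℝ × ℝ}, q ∈ segment ℝ u v → -q ∈ segment ℝ (-v) (-u) := by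
    rintro u v ⟨s, r, hs, hr, hsr, rfl⟩
    exact ⟨r, s, hr, hs, by linarith, by simp [add_comm]⟩
  have := ψ.covBy_right_unique_of_mem_segments (a := OrderDual.toDual b) ha.toDual hc.toDual
    hne (hneg h₁) (hneg h₂)
  exact neg_injective this

/-- The rotation (with scaling) that turns the product order into "higher". -/
def planeTurn : ℝ × ℝ →ₗ[ℝ] ℝ × ℝ :=
  (LinearMap.snd ℝ ℝ ℝ - LinearMap.fst ℝ ℝ ℝ).prod (LinearMap.fst ℝ ℝ ℝ + LinearMap.snd ℝ ℝ ℝ)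

theorem planeTurn_apply (q : ℝ × ℝ) : planeTurn q = (q.2 - q.1, q.1 + q.2) := rfl

theorem planeTurn_injective : Function.Injective planeTurn := by
  intro p q h
  simp only [planeTurn_apply, Prod.mk.injEq] at h
  ext <;> linarith [h.1, h.2]

theorem mem_segment_planeTurn {u v p : ℝ × ℝ} :
    p ∈ segment ℝ (planeTurn u) (planeTurn v) ↔ ∃ q ∈ segment ℝ u v, planeTurn q = p := by
  have := image_segment ℝ planeTurn.toAffineMap u v
  simp only [LinearMap.coe_toAffineMap] at this
  rw [← this]
  rfl

/-- A lattice that embeds, as an ordered set, into the plane with the product order has a planar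
diagram. -/
def PlanarDiagram.ofOrderEmbedding {L : Type*} [Lattice L] (φ : L ↪o ℝ × ℝ) : PlanarDiagram L where
  pos x := planeTurn (φ x)
  pos_injective := planeTurn_injective.comp φ.injective
  height_strictMono := by
    intro a b h
    have h' := (φ.lt_iff_lt.2 h)
    have hle := h'.le
    simp only [planeTurn_apply]
    by_contra! hn
    exact h'.ne (Prod.ext (by linarith [hle.1, hle.2]) (by linarith [hle.1, hle.2]))
  eq_of_mem_edge := by
    intro a b c hab hc
    obtain ⟨q, hq, hqc⟩ := mem_segment_planeTurn.1 hc
    obtain rfl := planeTurn_injective hqc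
    obtain ⟨h₁, h₂⟩ := segment_subset_Icc (φ.monotone hab.le) hq
    exact (hab.eq_or_eq (φ.le_iff_le.1 h₁) (φ.le_iff_le.1 h₂))
  edges_meet := by
    rintro a b c d hab hcd hne p ⟨hp₁, hp₂⟩
    obtain ⟨q, hq₁, rfl⟩ := mem_segment_planeTurn.1 hp₁
    obtain ⟨q', hq₂, hq'⟩ := mem_segment_planeTurn.1 hp₂
    obtain rfl := planeTurn_injective hq'
    obtain ⟨h₁, h₂⟩ := segment_subset_Icc (φ.monotone hab.le) hq₁
    obtain ⟨h₃, h₄⟩ := segment_subset_Icc (φ.monotone hcd.le) hq₂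
    -- A common point lies in the order intervals of both edges. Hence `a ⊔ c` lies on both
    -- coverings, and the edges share an endpoint.
    have had : a ≤ d := φ.le_iff_le.1 (h₁.trans h₄)
    have hcb : c ≤ b := φ.le_iff_le.1 (h₃.trans h₂)
    have e₁ := hab.eq_or_eq (c := a ⊔ c) le_sup_left (sup_le hab.le hcb)
    have e₂ := hcd.eq_or_eq (c := a ⊔ c) le_sup_right (sup_le had hcd.le)
    have main : (a = c ∨ b = d) ∨ (a = d ∨ b = c) := by
      rcases e₁ with e₁ | e₁ <;> rcases e₂ with e₂ | e₂ <;> rw [e₁] at e₂ <;> simp [e₂]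
    rcases main with (rfl | rfl) | (rfl | rfl)
    · refine ⟨a, Or.inl rfl, Or.inl rfl, congrArg _ ?_⟩
      exact φ.covBy_right_unique_of_mem_segments hab hcd (by rintro rfl; exact hne rfl) hq₁ hq₂
    · refine ⟨b, Or.inr rfl, Or.inr rfl, congrArg _ ?_⟩
      exact φ.covBy_left_unique_of_mem_segments hab hcd (by rintro rfl; exact hne rfl) hq₁ hq₂
    · exact ⟨a, Or.inl rfl, Or.inr rfl, congrArg _ (h₄.antisymm h₁)⟩
    · exact ⟨b, Or.inr rfl, Or.inl rfl, congrArg _ (h₂.antisymm h₃)⟩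

theorem PlanarDiagram.mem_support_ofOrderEmbedding {L : Type*} [Lattice L] (φ : L ↪o ℝ × ℝ)
    {p : ℝ × ℝ} (hp : p ∈ (PlanarDiagram.ofOrderEmbedding φ).support) {l u : ℝ × ℝ}
    (h : ∀ x, φ x ∈ Set.Icc l u) : ∃ q ∈ Set.Icc l u, planeTurn q = p := by
  rcases hp with ⟨x, rfl⟩ | ⟨a, b, -, hp⟩
  · exact ⟨φ x, h x, rfl⟩
  · obtain ⟨q, hq, rfl⟩ := mem_segment_planeTurn.1 hp
    exact ⟨q, (convex_Icc l u).segment_subset (h a) (h b) hq, rfl⟩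

/-! ### Adding doubly irreducible elements to a lattice -/

/-- A family of pairs `lo e < hi e` in `S`; one new element `e` is to be placed between the two. -/
structure EyeFamily (S E : Type*) [Lattice S] where
  lo : E → S
  hi : E → S
  lo_lt_hi : ∀ e, lo e < hi e

/-- The elements of `S` together with one new element for each member of the family. -/
inductive WithEyes {S E : Type*} [Lattice S] (A : EyeFamily S E) : Type _
  | old : S → WithEyes A
  | eye : E → WithEyes A

namespace WithEyes

variable {S E : Type*} [Lattice S] {A : EyeFamily S E}

/-- The largest old element below. -/
def lo : WithEyes A → S
  | old s => s
  | eye e => A.lo e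

/-- The smallest old element above. -/
def hi : WithEyes A → S
  | old s => s
  | eye e => A.hi e

@[simp] theorem lo_old (s : S) : (old s : WithEyes A).lo = s := rfl
@[simp] theorem hi_old (s : S) : (old s : WithEyes A).hi = s := rfl
@[simp] theorem lo_eye (e : E) : (eye e : WithEyes A).lo = A.lo e := rfl
@[simp] theorem hi_eye (e : E) : (eye e : WithEyes A).hi = A.hi e := rfl

theorem lo_le_hi (u : WithEyes A) : u.lo ≤ u.hi := by
  cases u with
  | old s => exact le_rfl
  | eye e => exact (A.lo_lt_hi e).le

theorem eq_old_of_hi_le_lo {u : WithEyes A} (h : u.hi ≤ u.lo) : u = old u.lo := by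
  cases u with
  | old s => rfl
  | eye e => exact absurd h (A.lo_lt_hi e).not_ge

/-- An old element has `lo = hi`, so the second alternative covers the order of `S` as well as all
strict relations that involve an eye. -/
instance : PartialOrder (WithEyes A) where
  le u v := u = v ∨ u.hi ≤ v.lo
  le_refl u := Or.inl rfl
  le_trans := by
    rintro u v w (rfl | h₁) (rfl | h₂)
    · exact Or.inl rfl
    · exact Or.inr h₂
    · exact Or.inr h₁
    · exact Or.inr (h₁.trans (v.lo_le_hi.trans h₂))
  le_antisymm := by
    rintro u v (rfl | h₁) (h | h₂)
    · rfl
    · rfl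
    · exact h.symm
    · have hu := u.lo_le_hi
      have hv := v.lo_le_hi
      rw [eq_old_of_hi_le_lo (h₁.trans (hv.trans h₂)), eq_old_of_hi_le_lo (h₂.trans (hu.trans h₁)),
        (hu.trans h₁).antisymm (hv.trans h₂)]

theorem le_def {u v : WithEyes A} : u ≤ v ↔ u = v ∨ u.hi ≤ v.lo := Iff.rfl

theorem le_of_hi_le_lo {u v : WithEyes A} (h : u.hi ≤ v.lo) : u ≤ v := Or.inr h

@[simp] theorem old_le {s : S} {u : WithEyes A} : old s ≤ u ↔ s ≤ u.lo := by
  constructor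
  · rintro (rfl | h)
    · exact le_rfl
    · exact h
  · exact Or.inr

@[simp] theorem le_old {s : S} {u : WithEyes A} : u ≤ old s ↔ u.hi ≤ s := by
  constructor
  · rintro (rfl | h)
    · exact le_rfl
    · exact h
  · exact Or.inr

theorem eye_le_eye {e e' : E} :
    (eye e : WithEyes A) ≤ eye e' ↔ e = e' ∨ A.hi e ≤ A.lo e' := by
  simp [le_def]

theorem lo_mono {u v : WithEyes A} (h : u ≤ v) : u.lo ≤ v.lo := by
  rcases h with rfl | h
  · exact le_rfl
  · exact u.lo_le_hi.trans h

theorem hi_mono {u v : WithEyes A} (h : u ≤ v) : u.hi ≤ v.hi := by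
  rcases h with rfl | h
  · exact le_rfl
  · exact h.trans v.lo_le_hi

@[simp] theorem old_lt_old {s t : S} : (old s : WithEyes A) < old t ↔ s < t := by
  simp [lt_iff_le_not_ge]

-- A common lower bound `w` of incomparable `u` and `v` differs from both, so `w.hi` is below `u.lo`
-- and `v.lo`. The meet is therefore an old element; dually for joins.
open Classical in
noncomputable instance : Lattice (WithEyes A) where
  inf u v := if u ≤ v then u else if v ≤ u then v else old (u.lo ⊓ v.lo)
  sup u v := if u ≤ v then v else if v ≤ u then u else old (u.hi ⊔ v.hi)
  inf_le_left u v := by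
    split_ifs with h₁ h₂
    · exact le_rfl
    · exact h₂
    · simp
  inf_le_right u v := by
    split_ifs with h₁ h₂
    · exact h₁
    · exact le_rfl
    · simp
  le_inf w u v hu hv := by
    split_ifs with h₁ h₂
    · exact hu
    · exact hv
    · rcases hu with rfl | hu
      · exact absurd hv h₁
      rcases hv with rfl | hv
      · exact absurd (le_of_hi_le_lo hu) h₂
      exact le_old.2 (le_inf hu hv)
  le_sup_left u v := by
    split_ifs with h₁ h₂
    · exact h₁
    · exact le_rfl
    · simp
  le_sup_right u v := by
    split_ifs with h₁ h₂
    · exact le_rfl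
    · exact h₂
    · simp
  sup_le u v w hu hv := by
    split_ifs with h₁ h₂
    · exact hv
    · exact hu
    · rcases hu with rfl | hu
      · exact absurd hv h₂
      rcases hv with rfl | hv
      · exact absurd (le_of_hi_le_lo hu) h₁
      exact old_le.2 (sup_le hu hv)

open Classical in
theorem inf_eq_of_not_le {u v : WithEyes A} (h₁ : ¬u ≤ v) (h₂ : ¬v ≤ u) :
    u ⊓ v = old (u.lo ⊓ v.lo) := by
  change (if u ≤ v then u else if v ≤ u then v else old (u.lo ⊓ v.lo)) = _
  rw [if_neg h₁, if_neg h₂]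

open Classical in
theorem sup_eq_of_not_le {u v : WithEyes A} (h₁ : ¬u ≤ v) (h₂ : ¬v ≤ u) :
    u ⊔ v = old (u.hi ⊔ v.hi) := by
  change (if u ≤ v then v else if v ≤ u then u else old (u.hi ⊔ v.hi)) = _
  rw [if_neg h₁, if_neg h₂]

@[simp] theorem old_inf_old (s t : S) : (old s ⊓ old t : WithEyes A) = old (s ⊓ t) :=
  le_antisymm (by
    rw [le_old]
    exact le_inf (le_old.1 inf_le_left) (le_old.1 inf_le_right)) (by simp)

@[simp] theorem old_sup_old (s t : S) : (old s ⊔ old t : WithEyes A) = old (s ⊔ t) :=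
  le_antisymm (by simp) (by
    rw [old_le]
    exact sup_le (old_le.1 le_sup_left) (old_le.1 le_sup_right))

/-- By `old_le`, `lo` is right adjoint to `old` and so preserves meets; by `le_old`, `hi` is left
adjoint and preserves joins. -/
theorem lo_inf (u v : WithEyes A) : (u ⊓ v).lo = u.lo ⊓ v.lo := by
  by_cases h₁ : u ≤ v
  · rw [inf_eq_left.2 h₁, inf_eq_left.2 (lo_mono h₁)]
  by_cases h₂ : v ≤ u
  · rw [inf_eq_right.2 h₂, inf_eq_right.2 (lo_mono h₂)]
  rw [inf_eq_of_not_le h₁ h₂, lo_old]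

theorem hi_sup (u v : WithEyes A) : (u ⊔ v).hi = u.hi ⊔ v.hi := by
  by_cases h₁ : u ≤ v
  · rw [sup_eq_right.2 h₁, sup_eq_right.2 (hi_mono h₁)]
  by_cases h₂ : v ≤ u
  · rw [sup_eq_left.2 h₂, sup_eq_left.2 (hi_mono h₂)]
  rw [sup_eq_of_not_le h₁ h₂, hi_old]

instance [BoundedOrder S] : BoundedOrder (WithEyes A) where
  top := old ⊤
  bot := old ⊥
  le_top := by simp
  bot_le := by simp

theorem top_eq [BoundedOrder S] : (⊤ : WithEyes A) = old ⊤ := rfl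
theorem bot_eq [BoundedOrder S] : (⊥ : WithEyes A) = old ⊥ := rfl

instance [Finite S] [Finite E] : Finite (WithEyes A) := by
  refine Finite.of_surjective (Sum.elim old eye : S ⊕ E → WithEyes A) ?_
  rintro (s | e)
  · exact ⟨Sum.inl s, rfl⟩
  · exact ⟨Sum.inr e, rfl⟩

/-! #### Semimodularity -/

theorem lo_covBy_eye (e : E) : old (A.lo e) ⋖ (eye e : WithEyes A) := by
  refine ⟨?_, ?_⟩
  · rw [lt_iff_le_not_ge]
    exact ⟨by simp, by simpa using (A.lo_lt_hi e).not_ge⟩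
  · intro u h₁ h₂
    rcases h₂.le with rfl | h
    · exact h₂.false
    · exact h₁.not_ge (le_old.2 h)

theorem eye_covBy_hi (e : E) : (eye e : WithEyes A) ⋖ old (A.hi e) := by
  refine ⟨?_, ?_⟩
  · rw [lt_iff_le_not_ge]
    exact ⟨by simp, by simpa using (A.lo_lt_hi e).not_ge⟩
  · intro u h₁ h₂
    rcases h₁.le with rfl | h
    · exact h₁.false
    · exact h₂.not_ge (old_le.2 h)

theorem eq_lo_of_covBy_eye {u : WithEyes A} {e : E} (h : u ⋖ eye e) : u = old (A.lo e) := by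
  rcases h.le with rfl | h'
  · exact absurd h.lt (lt_irrefl _)
  · rcases h.eq_or_eq (c := old (A.lo e)) (le_old.2 h') (by simp) with h'' | h''
    · exact h''.symm
    · cases h''

theorem covBy_of_old_covBy_old {s t : S} (h : (old s : WithEyes A) ⋖ old t) : s ⋖ t :=
  ⟨old_lt_old.1 h.lt, fun _ h₁ h₂ => h.2 (old_lt_old.2 h₁) (old_lt_old.2 h₂)⟩

/-- Every upper cover of `lo e` is a lower cover of `hi e`. -/
def IsShort (A : EyeFamily S E) : Prop := ∀ e s, A.lo e ⋖ s → s ⋖ A.hi e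

theorem IsShort.exists_between [Finite S] (hA : IsShort A) {e : E} {s : S} (h : A.lo e < s) :
    ∃ t, A.lo e ⋖ t ∧ t ≤ s ∧ t ⋖ A.hi e := by
  obtain ⟨t, ht, hts⟩ := exists_covBy_le_of_lt h
  exact ⟨t, ht, hts, hA e t ht⟩

/-- An eye between `s` and `t` would put the whole interval from `lo e` to `hi e` between them, but
that interval has an interior point. -/
theorem old_covBy_old [Finite S] (hA : IsShort A) {s t : S} (h : s ⋖ t) :
    (old s : WithEyes A) ⋖ old t := by
  refine ⟨old_lt_old.2 h.lt, ?_⟩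
  rintro (u | e) h₁ h₂
  · exact h.2 (old_lt_old.1 h₁) (old_lt_old.1 h₂)
  · have h₁' : s ≤ A.lo e := old_le.1 h₁.le
    have h₂' : A.hi e ≤ t := le_old.1 h₂.le
    obtain ⟨w, hw₁, -, hw₂⟩ := hA.exists_between (A.lo_lt_hi e)
    exact h.2 (h₁'.trans_lt hw₁.lt) (hw₂.lt.trans_le h₂')

/-- `s ⊔ hi e` covers `s` when `s` lies above `lo e`, but not above `hi e`. -/
theorem covBy_sup_hi [Finite S] [IsUpperModularLattice S] (hA : IsShort A) {e : E} {s : S}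
    (h : A.lo e < s) (h' : ¬A.hi e ≤ s) : s ⋖ A.hi e ⊔ s := by
  obtain ⟨t, ht, hts, hth⟩ := hA.exists_between h
  -- The meet `hi e ⊓ s` is a cover `t` of `lo e` below `s`, and `t` is a lower cover of `hi e`.
  refine IsUpperModularLattice.covBy_sup_of_inf_covBy ?_
  have : A.hi e ⊓ s = t := by
    rcases hth.eq_or_eq (c := A.hi e ⊓ s) (le_inf hth.le hts) inf_le_left with h | h
    · exact h
    · exact absurd (inf_eq_left.1 h) h'
  rwa [this]

/-- A covering of an eye from below starts at its `lo`, which reduces all cases to coverings in `S`.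
Injectivity of `lo` excludes two eyes over the same bottom, whose tops could differ. -/
theorem isUpperModularLattice [Finite S] [IsUpperModularLattice S] (hA : IsShort A)
    (hinj : ∀ e e', A.lo e = A.lo e' → e = e') : IsUpperModularLattice (WithEyes A) where
  covBy_sup_of_inf_covBy := by
    intro u v h
    have huv : ¬u ≤ v := fun h' => (inf_eq_left.2 h' ▸ h).lt.false
    by_cases hvu : v ≤ u
    · rwa [sup_eq_left.2 hvu, ← inf_eq_right.2 hvu]
    rw [inf_eq_of_not_le huv hvu] at h
    rw [sup_eq_of_not_le huv hvu]
    rcases u with s | e <;> rcases v with t | f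
    · exact old_covBy_old hA
        (IsUpperModularLattice.covBy_sup_of_inf_covBy (covBy_of_old_covBy_old h))
    · simp only [lo_old, lo_eye, hi_old, hi_eye] at h ⊢
      have h₁ := hA f _ (IsUpperModularLattice.covBy_sup_of_inf_covBy (covBy_of_old_covBy_old h))
      rw [sup_eq_right.2 (le_sup_left.trans h₁.le)]
      exact eye_covBy_hi f
    · simp only [lo_old, lo_eye, hi_old, hi_eye] at h ⊢
      have h₁ : A.lo e ⊓ t = A.lo e := by simpa using eq_lo_of_covBy_eye h
      have h₂ : A.lo e < t := (inf_eq_left.1 h₁).lt_of_ne (by rintro rfl; exact hvu (by simp))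
      exact old_covBy_old hA (covBy_sup_hi hA h₂ (by simpa using huv))
    · simp only [lo_eye, hi_eye] at h ⊢
      have h₁ : A.lo e ⊓ A.lo f = A.lo e := by simpa using eq_lo_of_covBy_eye h
      have h₂ : A.lo e < A.lo f := (inf_eq_left.1 h₁).lt_of_ne
        fun h => huv (by rw [hinj _ _ h])
      have h₃ := hA f _ (covBy_sup_hi hA h₂ fun h => huv (le_of_hi_le_lo h))
      rw [sup_eq_right.2 (le_sup_left.trans h₃.le)]
      exact eye_covBy_hi f

/-! #### Congruences -/

/-- The relation of the extended congruence: an eye between congruent elements is related to them,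
the other eyes are alone in their class. -/
def ExtendRel (θ : LatticeCon S) (u v : WithEyes A) : Prop :=
  u = v ∨ θ.r u.lo u.hi ∧ θ.r v.lo v.hi ∧ θ.r u.lo v.lo

namespace ExtendRel

variable {θ : LatticeCon S}

theorem symm {u v : WithEyes A} : ExtendRel θ u v → ExtendRel θ v u := by
  rintro (rfl | ⟨h₁, h₂, h₃⟩)
  · exact Or.inl rfl
  · exact Or.inr ⟨h₂, h₁, θ.symm h₃⟩

theorem trans {u v w : WithEyes A} : ExtendRel θ u v → ExtendRel θ v w → ExtendRel θ u w := by
  rintro (rfl | ⟨h₁, h₂, h₃⟩) (rfl | ⟨h₄, h₅, h₆⟩)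
  · exact Or.inl rfl
  · exact Or.inr ⟨h₄, h₅, h₆⟩
  · exact Or.inr ⟨h₁, h₂, h₃⟩
  · exact Or.inr ⟨h₁, h₅, θ.trans h₃ h₆⟩

theorem lo_hi_inf {u w : WithEyes A} (hu : θ.r u.lo u.hi) (hw : θ.r w.lo w.hi ∨ ¬w ≤ u) :
    θ.r (u ⊓ w).lo (u ⊓ w).hi := by
  by_cases h₁ : u ≤ w
  · rwa [inf_eq_left.2 h₁]
  by_cases h₂ : w ≤ u
  · rw [inf_eq_right.2 h₂]
    exact hw.resolve_right (not_not.2 h₂)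
  · rw [inf_eq_of_not_le h₁ h₂]
    exact θ.refl _

theorem lo_hi_sup {u w : WithEyes A} (hu : θ.r u.lo u.hi) (hw : θ.r w.lo w.hi ∨ ¬u ≤ w) :
    θ.r (u ⊔ w).lo (u ⊔ w).hi := by
  by_cases h₁ : u ≤ w
  · rw [sup_eq_right.2 h₁]
    exact hw.resolve_right (not_not.2 h₁)
  by_cases h₂ : w ≤ u
  · rwa [sup_eq_left.2 h₂]
  · rw [sup_eq_of_not_le h₁ h₂]
    exact θ.refl _

theorem of_hi {u v : WithEyes A} (hu : θ.r u.lo u.hi) (hv : θ.r v.lo v.hi)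
    (h : θ.r u.hi v.hi) : ExtendRel θ u v :=
  Or.inr ⟨hu, hv, θ.trans hu (θ.trans h (θ.symm hv))⟩

/-- As `e` is not collapsed, `eye e ≤ u` means `hi e ≤ u.lo`. Meeting with `hi e`, the least element
of its class, carries this over to `v`. -/
theorem eye_le_of_rel {e : E} (he : ¬θ.r (A.lo e) (A.hi e))
    (hmin : ∀ s, θ.r s (A.hi e) → A.hi e ≤ s) {u v : WithEyes A} (hu : θ.r u.lo u.hi)
    (h : θ.r u.lo v.lo) (hle : eye e ≤ u) : eye e ≤ v := by
  rcases hle with rfl | hle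
  · exact absurd hu he
  refine le_of_hi_le_lo ?_
  have h' := θ.inf h (θ.refl (A.hi e))
  rw [inf_eq_right.2 (show A.hi e ≤ u.lo from hle)] at h'
  exact (hmin _ (θ.symm h')).trans inf_le_left

theorem le_eye_of_rel {e : E} (he : ¬θ.r (A.lo e) (A.hi e))
    (hmax : ∀ s, θ.r s (A.lo e) → s ≤ A.lo e) {u v : WithEyes A} (hu : θ.r u.lo u.hi)
    (h : θ.r u.hi v.hi) (hle : u ≤ eye e) : v ≤ eye e := by
  rcases hle with rfl | hle
  · exact absurd hu he
  refine le_of_hi_le_lo ?_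
  have h' := θ.sup h (θ.refl (A.lo e))
  rw [sup_eq_right.2 (show u.hi ≤ A.lo e from hle)] at h'
  exact le_sup_left.trans (hmax _ (θ.symm h'))

/-- Congruent elements lie above the same uncollapsed eyes. Meeting both with such an eye thus gives
the eye twice, or two elements whose own `lo` and `hi` are congruent. -/
theorem inf_right
    (hθ : ∀ e, θ.r (A.lo e) (A.hi e) ∨
      ((∀ s, θ.r s (A.hi e) → A.hi e ≤ s) ∧ ∀ s, θ.r s (A.lo e) → s ≤ A.lo e))
    {u v : WithEyes A} (h : ExtendRel θ u v) (w : WithEyes A) :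
    ExtendRel θ (u ⊓ w) (v ⊓ w) := by
  rcases h with rfl | ⟨hu, hv, h⟩
  · exact Or.inl rfl
  have hlo : θ.r (u ⊓ w).lo (v ⊓ w).lo := by
    rw [lo_inf, lo_inf]
    exact θ.inf h (θ.refl _)
  by_cases hw : θ.r w.lo w.hi
  · exact Or.inr ⟨lo_hi_inf hu (Or.inl hw), lo_hi_inf hv (Or.inl hw), hlo⟩
  rcases w with s | e
  · exact absurd (θ.refl s) hw
  obtain ⟨hmin, -⟩ := (hθ e).resolve_left hw
  have hiff : eye e ≤ u ↔ eye e ≤ v :=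
    ⟨eye_le_of_rel hw hmin hu h, eye_le_of_rel hw hmin hv (θ.symm h)⟩
  by_cases he : eye e ≤ u
  · rw [inf_eq_right.2 he, inf_eq_right.2 (hiff.1 he)]
    exact Or.inl rfl
  · exact Or.inr ⟨lo_hi_inf hu (Or.inr he), lo_hi_inf hv (Or.inr (hiff.not.1 he)), hlo⟩

theorem sup_right
    (hθ : ∀ e, θ.r (A.lo e) (A.hi e) ∨
      ((∀ s, θ.r s (A.hi e) → A.hi e ≤ s) ∧ ∀ s, θ.r s (A.lo e) → s ≤ A.lo e))
    {u v : WithEyes A} (h : ExtendRel θ u v) (w : WithEyes A) :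
    ExtendRel θ (u ⊔ w) (v ⊔ w) := by
  rcases h with rfl | ⟨hu, hv, h⟩
  · exact Or.inl rfl
  have h : θ.r u.hi v.hi := θ.trans (θ.symm hu) (θ.trans h hv)
  have hhi : θ.r (u ⊔ w).hi (v ⊔ w).hi := by
    rw [hi_sup, hi_sup]
    exact θ.sup h (θ.refl _)
  by_cases hw : θ.r w.lo w.hi
  · exact of_hi (lo_hi_sup hu (Or.inl hw)) (lo_hi_sup hv (Or.inl hw)) hhi
  rcases w with s | e
  · exact absurd (θ.refl s) hw
  obtain ⟨-, hmax⟩ := (hθ e).resolve_left hw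
  have hiff : u ≤ eye e ↔ v ≤ eye e :=
    ⟨le_eye_of_rel hw hmax hu h, le_eye_of_rel hw hmax hv (θ.symm h)⟩
  by_cases he : u ≤ eye e
  · rw [sup_eq_right.2 he, sup_eq_right.2 (hiff.1 he)]
    exact Or.inl rfl
  · exact of_hi (lo_hi_sup hu (Or.inr he)) (lo_hi_sup hv (Or.inr (hiff.not.1 he))) hhi

end ExtendRel

/-- The extension of a congruence to the lattice with eyes. -/
def extendCon (θ : LatticeCon S)
    (hθ : ∀ e, θ.r (A.lo e) (A.hi e) ∨
      ((∀ s, θ.r s (A.hi e) → A.hi e ≤ s) ∧ ∀ s, θ.r s (A.lo e) → s ≤ A.lo e)) :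
    LatticeCon (WithEyes A) where
  r := ExtendRel θ
  iseqv := ⟨fun _ => Or.inl rfl, ExtendRel.symm, ExtendRel.trans⟩
  inf {w x y z} h k := by
    refine (ExtendRel.inf_right hθ h y).trans ?_
    rw [inf_comm x y, inf_comm x z]
    exact ExtendRel.inf_right hθ k x
  sup {w x y z} h k := by
    refine (ExtendRel.sup_right hθ h y).trans ?_
    rw [sup_comm x y, sup_comm x z]
    exact ExtendRel.sup_right hθ k x

end WithEyes

/-! ### Forked grids -/

/-- The data for a square grid with forks: its size and the positions of the forks on the
diagonal. -/
structure ForkPattern where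
  size : ℕ
  forks : Set ℕ
  lt_size : ∀ {f}, f ∈ forks → f < size
  succ_notMem : ∀ {f}, f ∈ forks → f + 1 ∉ forks
  zero_notMem : 0 ∉ forks

namespace ForkPattern

variable (G : ForkPattern)

/-- The points of the grid `[0, size]²`, without those that lie strictly to the right of or
strictly above a diagonal point `(f, f)` with a fork. -/
@[ext]
structure Grid where
  x : ℕ
  y : ℕ
  x_le : x ≤ G.size
  y_le : y ≤ G.size
  y_notMem : y < x → y ∉ G.forks
  x_notMem : x < y → x ∉ G.forks

namespace Grid

variable {G}

instance : PartialOrder G.Grid :=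
  PartialOrder.lift (fun g => (g.x, g.y)) fun g h e => by
    simp only [Prod.mk.injEq] at e
    exact Grid.ext e.1 e.2

theorem le_def {g h : G.Grid} : g ≤ h ↔ g.x ≤ h.x ∧ g.y ≤ h.y := Iff.rfl

instance : Finite G.Grid := by
  refine Finite.of_injective (β := Fin (G.size + 1) × Fin (G.size + 1))
    (fun g => (⟨g.x, Nat.lt_succ_of_le g.x_le⟩, ⟨g.y, Nat.lt_succ_of_le g.y_le⟩)) ?_
  intro g h e
  simp only [Prod.mk.injEq, Fin.mk.injEq] at e
  exact Grid.ext e.1 e.2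

end Grid

open Classical in
/-- The smallest coordinate `≥ a` that can be paired with `b`. -/
noncomputable def shift (a b : ℕ) : ℕ := if a ∈ G.forks ∧ a < b then a + 1 else a

theorem shift_cases (a b : ℕ) :
    (G.shift a b = a + 1 ∧ a ∈ G.forks ∧ a < b) ∨ (G.shift a b = a ∧ (a ∈ G.forks → b ≤ a)) := by
  unfold shift
  split_ifs with h
  · exact Or.inl ⟨rfl, h⟩
  · exact Or.inr ⟨rfl, fun ha => not_lt.1 fun hb => h ⟨ha, hb⟩⟩

theorem shift_eq_self {a b : ℕ} (h : a < b → a ∉ G.forks) : G.shift a b = a := by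
  rcases G.shift_cases a b with ⟨-, h₁, h₂⟩ | ⟨h₁, -⟩
  · exact absurd h₁ (h h₂)
  · exact h₁

theorem shift_eq_succ {a b : ℕ} (h : a ∈ G.forks) (hab : a < b) : G.shift a b = a + 1 := by
  rcases G.shift_cases a b with ⟨h₁, -⟩ | ⟨-, h₂⟩
  · exact h₁
  · exact absurd (h₂ h) hab.not_ge

theorem shift_le_size {a b : ℕ} (ha : a ≤ G.size) : G.shift a b ≤ G.size := by
  rcases G.shift_cases a b with ⟨h, h₁, -⟩ | ⟨h, -⟩
  · have := G.lt_size h₁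
    omega
  · omega

theorem le_shift (a b : ℕ) : a ≤ G.shift a b := by
  rcases G.shift_cases a b with ⟨h, -⟩ | ⟨h, -⟩ <;> omega

/-- One shift is enough, because no two forks are adjacent. -/
theorem shift_notMem {a b : ℕ} (h : G.shift a b < G.shift b a) : G.shift a b ∉ G.forks := by
  rcases G.shift_cases a b with ⟨h₁, h₂, -⟩ | ⟨h₁, h₂⟩
  · rw [h₁]
    exact G.succ_notMem h₂
  · rw [h₁] at h ⊢
    intro ha
    have := h₂ ha
    rcases G.shift_cases b a with ⟨h₃, -, h₄⟩ | ⟨h₃, -⟩ <;> omega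

/-- The smallest grid point above `(a, b)`. -/
noncomputable def up (a b : ℕ) (ha : a ≤ G.size) (hb : b ≤ G.size) : G.Grid where
  x := G.shift a b
  y := G.shift b a
  x_le := G.shift_le_size ha
  y_le := G.shift_le_size hb
  x_notMem := G.shift_notMem
  y_notMem := G.shift_notMem

variable {G}

@[simp] theorem up_x {a b : ℕ} (ha : a ≤ G.size) (hb : b ≤ G.size) :
    (G.up a b ha hb).x = G.shift a b := rfl

@[simp] theorem up_y {a b : ℕ} (ha : a ≤ G.size) (hb : b ≤ G.size) :
    (G.up a b ha hb).y = G.shift b a := rfl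

theorem up_le_iff {a b : ℕ} {ha : a ≤ G.size} {hb : b ≤ G.size} {g : G.Grid} :
    G.up a b ha hb ≤ g ↔ a ≤ g.x ∧ b ≤ g.y := by
  constructor
  · rintro ⟨h₁, h₂⟩
    exact ⟨(G.le_shift a b).trans h₁, (G.le_shift b a).trans h₂⟩
  · rintro ⟨h₁, h₂⟩
    -- If `a` has to be shifted, then `x = a` is impossible: `(a, y)` with `y ≥ b > a` has been
    -- removed.
    have key : ∀ {a b x y : ℕ}, a ≤ x → b ≤ y → (x < y → x ∉ G.forks) → G.shift a b ≤ x := by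
      intro a b x y hax hby hx
      rcases G.shift_cases a b with ⟨h, h', h''⟩ | ⟨h, -⟩
      · rcases hax.eq_or_lt with rfl | h₃
        · exact absurd h' (hx (by omega))
        · omega
      · omega
    exact ⟨key h₁ h₂ g.x_notMem, key h₂ h₁ g.y_notMem⟩

namespace Grid

theorem up_self (g : G.Grid) : G.up g.x g.y g.x_le g.y_le = g :=
  Grid.ext (G.shift_eq_self g.x_notMem) (G.shift_eq_self g.y_notMem)

noncomputable instance : Lattice G.Grid where
  inf g h :=
    { x := min g.x h.x
      y := min g.y h.y
      x_le := (min_le_left _ _).trans g.x_le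
      y_le := (min_le_left _ _).trans g.y_le
      x_notMem := by
        intro hlt
        rcases min_cases g.x h.x with ⟨e, -⟩ | ⟨e, -⟩ <;> rw [e] at hlt ⊢
        · exact g.x_notMem (hlt.trans_le (min_le_left _ _))
        · exact h.x_notMem (hlt.trans_le (min_le_right _ _))
      y_notMem := by
        intro hlt
        rcases min_cases g.y h.y with ⟨e, -⟩ | ⟨e, -⟩ <;> rw [e] at hlt ⊢
        · exact g.y_notMem (hlt.trans_le (min_le_left _ _))
        · exact h.y_notMem (hlt.trans_le (min_le_right _ _)) }
  sup g h := G.up (max g.x h.x) (max g.y h.y) (max_le g.x_le h.x_le) (max_le g.y_le h.y_le)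
  inf_le_left g h := ⟨min_le_left _ _, min_le_left _ _⟩
  inf_le_right g h := ⟨min_le_right _ _, min_le_right _ _⟩
  le_inf _ _ _ h₁ h₂ := ⟨le_min h₁.1 h₂.1, le_min h₁.2 h₂.2⟩
  le_sup_left _ _ :=
    ⟨(le_max_left _ _).trans (G.le_shift _ _), (le_max_left _ _).trans (G.le_shift _ _)⟩
  le_sup_right _ _ :=
    ⟨(le_max_right _ _).trans (G.le_shift _ _), (le_max_right _ _).trans (G.le_shift _ _)⟩
  sup_le _ _ _ h₁ h₂ := up_le_iff.2 ⟨max_le h₁.1 h₂.1, max_le h₁.2 h₂.2⟩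

@[simp] theorem inf_x (g h : G.Grid) : (g ⊓ h).x = min g.x h.x := rfl
@[simp] theorem inf_y (g h : G.Grid) : (g ⊓ h).y = min g.y h.y := rfl
theorem sup_x (g h : G.Grid) :
    (g ⊔ h).x = G.shift (max g.x h.x) (max g.y h.y) := rfl
theorem sup_y (g h : G.Grid) :
    (g ⊔ h).y = G.shift (max g.y h.y) (max g.x h.x) := rfl

instance : BoundedOrder G.Grid where
  top := ⟨G.size, G.size, le_rfl, le_rfl, fun h => absurd h (lt_irrefl _),
    fun h => absurd h (lt_irrefl _)⟩
  bot := ⟨0, 0, zero_le, zero_le, fun h => absurd h (lt_irrefl _),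
    fun h => absurd h (lt_irrefl _)⟩
  le_top g := ⟨g.x_le, g.y_le⟩
  bot_le _ := ⟨zero_le, zero_le⟩

@[simp] theorem top_x : (⊤ : G.Grid).x = G.size := rfl
@[simp] theorem top_y : (⊤ : G.Grid).y = G.size := rfl
@[simp] theorem bot_x : (⊥ : G.Grid).x = 0 := rfl
@[simp] theorem bot_y : (⊥ : G.Grid).y = 0 := rfl

/-! ### Coverings and semimodularity of the forked grid -/

theorem lt_iff {g h : G.Grid} :
    g < h ↔ g.x ≤ h.x ∧ g.y ≤ h.y ∧ (g.x < h.x ∨ g.y < h.y) := by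
  rw [lt_iff_le_not_ge, le_def, le_def]
  omega

/-- If `(x + 1, y)` is missing, either it lies above the fork of column `x + 1`, and the cover is
`(x + 2, y)`, or `g` is a fork point `(f, f)`, and the cover is `(f + 1, f + 1)`. In both cases the
points in between are missing, too. -/
theorem covBy_up_right (g : G.Grid) (h : g.x + 1 ≤ G.size) :
    g ⋖ G.up (g.x + 1) g.y h g.y_le := by
  refine ⟨lt_iff.2 ?_, ?_⟩
  · have h₁ := G.le_shift (g.x + 1) g.y
    have h₂ := G.le_shift g.y (g.x + 1)
    simp only [up_x, up_y]
    omega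
  · intro w h₁ h₂
    rw [lt_iff] at h₁ h₂
    simp only [up_x, up_y] at h₂
    have hx := g.x_notMem
    have hy := g.y_notMem
    have wx := w.x_notMem
    have wy := w.y_notMem
    rcases G.shift_cases (g.x + 1) g.y with ⟨e₁, m₁, l₁⟩ | ⟨e₁, m₁⟩ <;>
    rcases G.shift_cases g.y (g.x + 1) with ⟨e₂, m₂, l₂⟩ | ⟨e₂, m₂⟩ <;> rw [e₁, e₂] at h₂
    · omega
    · have e : w.x = g.x + 1 := by omega
      exact absurd m₁ (e ▸ wx (by omega))
    · have hxy : g.x = g.y := by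
        by_contra hne
        exact hy (by omega) m₂
      by_cases hw : w.x = g.x
      · exact wx (by omega) (by rwa [hw, hxy])
      · have : w.y = g.y := by omega
        exact wy (by omega) (by rwa [this])
    · omega

/-- The reflection of the grid in its diagonal. -/
@[simps]
def swap (g : G.Grid) : G.Grid := ⟨g.y, g.x, g.y_le, g.x_le, g.x_notMem, g.y_notMem⟩

theorem swap_lt_swap {g h : G.Grid} : g.swap < h.swap ↔ g < h := by
  simp only [lt_iff, swap_x, swap_y]
  omega

theorem covBy_up_left (g : G.Grid) (h : g.y + 1 ≤ G.size) :
    g ⋖ G.up g.x (g.y + 1) g.x_le h := by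
  have := g.swap.covBy_up_right h
  refine ⟨swap_lt_swap.1 this.1, ?_⟩
  intro w h₁ h₂
  exact this.2 (swap_lt_swap.2 h₁) (swap_lt_swap.2 h₂)

theorem exists_up_of_covBy {g h : G.Grid} (hgh : g ⋖ h) :
    (∃ hs, h = G.up (g.x + 1) g.y hs g.y_le) ∨ ∃ hs, h = G.up g.x (g.y + 1) g.x_le hs := by
  obtain ⟨h₁, h₂, h₃⟩ := lt_iff.1 hgh.lt
  rcases h₃ with h₃ | h₃
  · have hs : g.x + 1 ≤ G.size := (Nat.succ_le_of_lt h₃).trans h.x_le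
    refine Or.inl ⟨hs, ?_⟩
    have hc := g.covBy_up_right hs
    exact ((hgh.eq_or_eq hc.le (up_le_iff.2 ⟨h₃, h₂⟩)).resolve_left hc.lt.ne').symm
  · have hs : g.y + 1 ≤ G.size := (Nat.succ_le_of_lt h₃).trans h.y_le
    refine Or.inr ⟨hs, ?_⟩
    have hc := g.covBy_up_left hs
    exact ((hgh.eq_or_eq hc.le (up_le_iff.2 ⟨h₁, h₃⟩)).resolve_left hc.lt.ne').symm

/-- A covering of `o` is a unit step in one coordinate, rounded up to the grid. If `v ≥ o` is not
above the result, it agrees with `o` in that coordinate, and the join with `v` is the same step made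
from `v`. -/
instance : IsUpperModularLattice G.Grid where
  covBy_sup_of_inf_covBy := by
    intro u v h
    have huv : ¬u ≤ v := fun h' => (inf_eq_left.2 h' ▸ h).lt.false
    have hle : u ⊓ v ≤ v := inf_le_right
    generalize u ⊓ v = o at h hle
    rcases exists_up_of_covBy h with ⟨hs, rfl⟩ | ⟨hs, rfl⟩
    · rw [up_le_iff] at huv
      have hx : v.x = o.x := by
        have := hle.1
        have := hle.2
        simp only at *
        omega
      have hs' : v.x + 1 ≤ G.size := by omega
      have : G.up (o.x + 1) o.y hs o.y_le ⊔ v = G.up (v.x + 1) v.y hs' v.y_le := by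
        apply le_antisymm
        · refine sup_le (up_le_iff.2 ⟨?_, ?_⟩) (v.covBy_up_right hs').le
          · rw [← hx]; exact G.le_shift _ _
          · exact hle.2.trans (G.le_shift _ _)
        · rw [up_le_iff]
          refine ⟨?_, (le_def.1 le_sup_right).2⟩
          rw [hx]
          exact (up_le_iff.1 le_sup_left).1
      rw [this]
      exact v.covBy_up_right hs'
    · rw [up_le_iff] at huv
      have hy : v.y = o.y := by
        have := hle.1
        have := hle.2
        simp only at *
        omega
      have hs' : v.y + 1 ≤ G.size := by omega
      have : G.up o.x (o.y + 1) o.x_le hs ⊔ v = G.up v.x (v.y + 1) v.x_le hs' := by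
        apply le_antisymm
        · refine sup_le (up_le_iff.2 ⟨?_, ?_⟩) (v.covBy_up_left hs').le
          · exact hle.1.trans (G.le_shift _ _)
          · rw [← hy]; exact G.le_shift _ _
        · rw [up_le_iff]
          refine ⟨(le_def.1 le_sup_right).1, ?_⟩
          rw [hy]
          exact (up_le_iff.1 le_sup_left).2
      rw [this]
      exact v.covBy_up_left hs'

end Grid

end ForkPattern

/-! ### Coloured forked grids with eyes -/

/-- A forked grid whose lines (the `k`-th one lies between the coordinates `k` and `k + 1`) are
coloured by a preordered set `P`. The first `free` lines show all colours and have no forks; the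
forks show all pairs of comparable colours. -/
structure Palette (P : Type*) [Preorder P] extends ForkPattern where
  color : ℕ → P
  free : ℕ
  free_pos : 0 < free
  free_le_size : free ≤ size
  free_lt : ∀ {f}, f ∈ forks → free < f
  exists_color : ∀ p, ∃ k < free, color k = p
  color_le : ∀ {f}, f ∈ forks → color f ≤ color (f - 1)
  exists_fork : ∀ {p q}, p ≤ q → ∃ f ∈ forks, color (f - 1) = q ∧ color f = p

namespace Palette

open ForkPattern

variable {P : Type*} [Preorder P] (C : Palette P)

/-- The cells that get an eye: those with a free side and with sides of the same colour. -/
@[ext]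
structure Cell where
  i : ℕ
  j : ℕ
  i_lt : i < C.size
  j_lt : j < C.size
  free_or : i < C.free ∨ j < C.free
  color_eq : C.color i = C.color j

variable {C}

instance : Finite C.Cell := by
  refine Finite.of_injective (β := Fin C.size × Fin C.size)
    (fun g => (⟨g.i, g.i_lt⟩, ⟨g.j, g.j_lt⟩)) ?_
  intro g h e
  simp only [Prod.mk.injEq, Fin.mk.injEq] at e
  exact Cell.ext e.1 e.2

theorem notMem_of_le_free {f : ℕ} (h : f ≤ C.free) : f ∉ C.forks :=
  fun hf => (C.free_lt hf).not_ge h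

/-- Points with a free coordinate belong to the grid. -/
def point (C : Palette P) (a b : ℕ) (ha : a ≤ C.size) (hb : b ≤ C.size)
    (h : a ≤ C.free ∨ b ≤ C.free) : C.Grid where
  x := a
  y := b
  x_le := ha
  y_le := hb
  x_notMem hlt := notMem_of_le_free (by omega)
  y_notMem hlt := notMem_of_le_free (by omega)

@[simp] theorem point_x {a b : ℕ} {ha : a ≤ C.size} {hb : b ≤ C.size}
    {h : a ≤ C.free ∨ b ≤ C.free} : (C.point a b ha hb h).x = a := rfl

@[simp] theorem point_y {a b : ℕ} {ha : a ≤ C.size} {hb : b ≤ C.size}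
    {h : a ≤ C.free ∨ b ≤ C.free} : (C.point a b ha hb h).y = b := rfl

theorem up_eq_point {a b : ℕ} (ha : a ≤ C.size) (hb : b ≤ C.size)
    (h : a ≤ C.free ∨ b ≤ C.free) : C.up a b ha hb = C.point a b ha hb h :=
  (C.point a b ha hb h).up_self

/-- The corners of a cell. -/
def Cell.bot (e : C.Cell) : C.Grid :=
  C.point e.i e.j e.i_lt.le e.j_lt.le (by have := e.free_or; omega)

/-- The left corner of a cell. -/
def Cell.left (e : C.Cell) : C.Grid :=
  C.point (e.i + 1) e.j e.i_lt e.j_lt.le (by have := e.free_or; omega)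

/-- The right corner of a cell. -/
def Cell.right (e : C.Cell) : C.Grid :=
  C.point e.i (e.j + 1) e.i_lt.le e.j_lt (by have := e.free_or; omega)

/-- The top of a cell. -/
def Cell.top (e : C.Cell) : C.Grid :=
  C.point (e.i + 1) (e.j + 1) e.i_lt e.j_lt (by have := e.free_or; omega)

theorem Cell.bot_covBy_left (e : C.Cell) : e.bot ⋖ e.left := by
  have := e.bot.covBy_up_right e.i_lt
  rwa [show C.up (e.bot.x + 1) e.bot.y _ _ = e.left from up_eq_point _ _ _] at this

theorem Cell.bot_covBy_right (e : C.Cell) : e.bot ⋖ e.right := by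
  have := e.bot.covBy_up_left e.j_lt
  rwa [show C.up e.bot.x (e.bot.y + 1) _ _ = e.right from up_eq_point _ _ _] at this

theorem Cell.left_covBy_top (e : C.Cell) : e.left ⋖ e.top := by
  have := e.left.covBy_up_left e.j_lt
  rwa [show C.up e.left.x (e.left.y + 1) _ _ = e.top from up_eq_point _ _ _] at this

theorem Cell.right_covBy_top (e : C.Cell) : e.right ⋖ e.top := by
  have := e.right.covBy_up_right e.i_lt
  rwa [show C.up (e.right.x + 1) e.right.y _ _ = e.top from up_eq_point _ _ _] at this

/-- The eyes of a coloured grid. -/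
def eyes (C : Palette P) : EyeFamily C.Grid C.Cell where
  lo := Cell.bot
  hi := Cell.top
  lo_lt_hi e := e.bot_covBy_left.lt.trans e.left_covBy_top.lt

@[simp] theorem eyes_lo (e : C.Cell) : C.eyes.lo e = e.bot := rfl
@[simp] theorem eyes_hi (e : C.Cell) : C.eyes.hi e = e.top := rfl

theorem isShort_eyes : WithEyes.IsShort C.eyes := by
  intro e s hs
  rcases Grid.exists_up_of_covBy hs with ⟨h, rfl⟩ | ⟨h, rfl⟩
  · have : C.up (e.bot.x + 1) e.bot.y h e.bot.y_le = e.left := up_eq_point _ _ _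
    exact this ▸ e.left_covBy_top
  · have : C.up e.bot.x (e.bot.y + 1) e.bot.x_le h = e.right := up_eq_point _ _ _
    exact this ▸ e.right_covBy_top

/-- The lattice of a coloured grid: the forked grid together with its eyes. -/
abbrev Lat (C : Palette P) : Type := WithEyes C.eyes

instance : IsUpperModularLattice C.Lat :=
  WithEyes.isUpperModularLattice isShort_eyes fun _ _ h =>
    Cell.ext (congrArg Grid.x h) (congrArg Grid.y h)

/-! #### The diagram -/

/-- The coordinates of an element. In every line of cells, the eyes form a descending sequence. -/
noncomputable def coord : C.Lat → ℝ × ℝ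
  | .old g => (g.x, g.y)
  -- Eyes with a common index are incomparable, so each offset decreases in the other index. The
  -- summand `2` keeps offsets at most `1 / 2`, so that their sum does not exceed the length of a
  -- cell side.
  | .eye e => (e.i + 1 / (e.j + 2), e.j + 1 / (e.i + 2))

theorem natCast_add_le_natCast_add_iff {a b c d : ℕ} :
    (a : ℝ) + 1 / (b + 2) ≤ c + 1 / (d + 2) ↔ a < c ∨ a = c ∧ d ≤ b := by
  have hb : (0 : ℝ) < b + 2 := by positivity
  have hd : (0 : ℝ) < d + 2 := by positivity
  have hb' : (1 : ℝ) / (b + 2) < 1 := by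
    rw [div_lt_one hb]
    linarith [(Nat.cast_nonneg b : (0 : ℝ) ≤ b)]
  have hd' : (1 : ℝ) / (d + 2) < 1 := by
    rw [div_lt_one hd]
    linarith [(Nat.cast_nonneg d : (0 : ℝ) ≤ d)]
  have hb₀ := one_div_pos.2 hb
  have hd₀ := one_div_pos.2 hd
  rcases lt_trichotomy a c with h | rfl | h
  · have : (a : ℝ) + 1 ≤ c := by exact_mod_cast h
    simp only [h, true_or, iff_true]
    linarith
  · simp only [lt_irrefl, false_or, true_and, add_le_add_iff_left]
    rw [one_div_le_one_div hb hd]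
    simp
  · have : (c : ℝ) + 1 ≤ a := by exact_mod_cast h
    have h' : ¬(a < c ∨ a = c ∧ d ≤ b) := by omega
    simp only [h', iff_false, not_le]
    linarith

theorem natCast_le_natCast_add_iff {a c d : ℕ} : (a : ℝ) ≤ c + 1 / (d + 2) ↔ a ≤ c := by
  have hd : (0 : ℝ) < d + 2 := by positivity
  have hd' : (1 : ℝ) / (d + 2) < 1 := by
    rw [div_lt_one hd]
    linarith [(Nat.cast_nonneg d : (0 : ℝ) ≤ d)]
  have hd₀ := one_div_pos.2 hd
  constructor
  · intro h
    by_contra! hlt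
    have : (c : ℝ) + 1 ≤ a := by exact_mod_cast hlt
    linarith
  · intro h
    have : (a : ℝ) ≤ c := by exact_mod_cast h
    linarith

theorem natCast_add_le_natCast_iff {a b c : ℕ} : (a : ℝ) + 1 / (b + 2) ≤ c ↔ a + 1 ≤ c := by
  have hb : (0 : ℝ) < b + 2 := by positivity
  have hb' : (1 : ℝ) / (b + 2) < 1 := by
    rw [div_lt_one hb]
    linarith [(Nat.cast_nonneg b : (0 : ℝ) ≤ b)]
  have hb₀ := one_div_pos.2 hb
  constructor
  · intro h
    by_contra! hlt
    have : (c : ℝ) ≤ a := by exact_mod_cast Nat.le_of_lt_succ hlt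
    linarith
  · intro h
    have : (a : ℝ) + 1 ≤ c := by exact_mod_cast h
    linarith

theorem coord_le_coord {u v : C.Lat} : coord u ≤ coord v ↔ u ≤ v := by
  rcases u with g | e <;> rcases v with h | f
  · rw [WithEyes.old_le, WithEyes.lo_old, Grid.le_def, Prod.le_def]
    simp only [coord, Nat.cast_le]
  · rw [WithEyes.old_le, WithEyes.lo_eye, Grid.le_def, Prod.le_def]
    simp only [coord]
    rw [natCast_le_natCast_add_iff, natCast_le_natCast_add_iff]
    rfl
  · rw [WithEyes.le_old, WithEyes.hi_eye, Grid.le_def, Prod.le_def]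
    simp only [coord]
    rw [natCast_add_le_natCast_iff, natCast_add_le_natCast_iff]
    rfl
  · rw [WithEyes.eye_le_eye, Cell.ext_iff, Grid.le_def, Prod.le_def]
    simp only [coord]
    rw [natCast_add_le_natCast_add_iff, natCast_add_le_natCast_add_iff]
    simp only [eyes_lo, eyes_hi, Cell.bot, Cell.top, point_x, point_y]
    omega

/-- The coordinates as an order embedding. -/
noncomputable def coordEmbedding (C : Palette P) : C.Lat ↪o ℝ × ℝ :=
  OrderEmbedding.ofMapLEIff coord fun _ _ => coord_le_coord

/-- The planar diagram of the lattice. -/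
noncomputable def diagram (C : Palette P) : PlanarDiagram C.Lat :=
  PlanarDiagram.ofOrderEmbedding C.coordEmbedding

theorem diagram_pos (u : C.Lat) : C.diagram.pos u = planeTurn (coord u) := rfl

theorem coord_mem_Icc (u : C.Lat) : coord u ∈ Set.Icc ((0, 0) : ℝ × ℝ) (C.size, C.size) := by
  have h₀ : coord (⊥ : C.Lat) = (0, 0) := by
    rw [WithEyes.bot_eq]
    simp [coord]
  have h₁ : coord (⊤ : C.Lat) = ((C.size : ℝ), (C.size : ℝ)) := by
    rw [WithEyes.top_eq]
    simp [coord]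
  rw [← h₀, ← h₁]
  exact ⟨coord_le_coord.2 bot_le, coord_le_coord.2 le_top⟩

/-- The left corner of the grid. -/
def leftCorner (C : Palette P) : C.Grid := C.point C.size 0 le_rfl zero_le (Or.inr zero_le)

/-- The right corner of the grid. -/
def rightCorner (C : Palette P) : C.Grid := C.point 0 C.size zero_le le_rfl (Or.inl zero_le)

theorem exists_of_mem_support {p : ℝ × ℝ} (hp : p ∈ C.diagram.support) :
    ∃ a b : ℝ, 0 ≤ a ∧ 0 ≤ b ∧ a ≤ C.size ∧ b ≤ C.size ∧ p = (b - a, a + b) := by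
  obtain ⟨q, hq, rfl⟩ := PlanarDiagram.mem_support_ofOrderEmbedding C.coordEmbedding hp
    (l := (0, 0)) (u := (C.size, C.size)) coord_mem_Icc
  exact ⟨q.1, q.2, hq.1.1, hq.1.2, hq.2.1, hq.2.2, planeTurn_apply q⟩

theorem leftCorner_mem_leftBoundary : WithEyes.old C.leftCorner ∈ C.diagram.leftBoundary := by
  intro p hp _
  obtain ⟨a, b, h₁, h₂, h₃, h₄, rfl⟩ := exists_of_mem_support hp
  simp only [diagram_pos, planeTurn_apply, coord, leftCorner, point_x, point_y]
  push_cast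
  linarith

theorem rightCorner_mem_rightBoundary : WithEyes.old C.rightCorner ∈ C.diagram.rightBoundary := by
  intro p hp _
  obtain ⟨a, b, h₁, h₂, h₃, h₄, rfl⟩ := exists_of_mem_support hp
  simp only [diagram_pos, planeTurn_apply, coord, rightCorner, point_x, point_y]
  push_cast
  linarith

theorem size_pos (C : Palette P) : 0 < C.size := C.free_pos.trans_le C.free_le_size

theorem rightCorner_notMem_leftBoundary :
    WithEyes.old C.rightCorner ∉ C.diagram.leftBoundary := by
  intro h
  have := h (C.diagram.pos (WithEyes.old C.leftCorner)) (Or.inl ⟨_, rfl⟩)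
    (by simp [diagram_pos, planeTurn_apply, coord, leftCorner, rightCorner])
  simp only [diagram_pos, planeTurn_apply, coord, leftCorner, rightCorner, point_x, point_y]
    at this
  have hpos : (0 : ℝ) < C.size := by exact_mod_cast C.size_pos
  push_cast at this
  linarith

theorem leftCorner_notMem_rightBoundary :
    WithEyes.old C.leftCorner ∉ C.diagram.rightBoundary := by
  intro h
  have := h (C.diagram.pos (WithEyes.old C.rightCorner)) (Or.inl ⟨_, rfl⟩)
    (by simp [diagram_pos, planeTurn_apply, coord, leftCorner, rightCorner])
  simp only [diagram_pos, planeTurn_apply, coord, leftCorner, rightCorner, point_x, point_y]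
    at this
  have hpos : (0 : ℝ) < C.size := by exact_mod_cast C.size_pos
  push_cast at this
  linarith

theorem one_div_natCast_add_two (n : ℕ) :
    0 < (1 : ℝ) / (n + 2) ∧ (1 : ℝ) / (n + 2) ≤ 1 / 2 := by
  refine ⟨by positivity, ?_⟩
  apply one_div_le_one_div_of_le two_pos
  linarith [(Nat.cast_nonneg n : (0 : ℝ) ≤ n)]

theorem eye_notMem_leftBoundary (e : C.Cell) : WithEyes.eye e ∉ C.diagram.leftBoundary := by
  intro h
  obtain ⟨h₁, h₂⟩ := one_div_natCast_add_two e.i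
  obtain ⟨h₃, h₄⟩ := one_div_natCast_add_two e.j
  have hcov := WithEyes.old_covBy_old (A := C.eyes) isShort_eyes e.bot_covBy_left
  -- The eye has height `i + j + δ` with `δ ≤ 1`. The lower left edge of its cell has a point of
  -- this height, further to the left.
  set δ : ℝ := 1 / (e.i + 2) + 1 / (e.j + 2) with hδ
  have := h (planeTurn (e.i + δ, e.j)) ?_ ?_
  · simp only [diagram_pos, planeTurn_apply, coord] at this
    linarith
  · refine Or.inr ⟨_, _, hcov, ?_⟩
    rw [diagram_pos, diagram_pos, mem_segment_planeTurn]
    refine ⟨_, ?_, rfl⟩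
    refine ⟨1 - δ, δ, by linarith, by linarith, by ring, ?_⟩
    simp only [coord, Cell.bot, Cell.left, point_x, point_y]
    ext <;> simp <;> ring
  · simp only [diagram_pos, planeTurn_apply, coord]
    linarith

theorem eye_notMem_rightBoundary (e : C.Cell) : WithEyes.eye e ∉ C.diagram.rightBoundary := by
  intro h
  obtain ⟨h₁, h₂⟩ := one_div_natCast_add_two e.i
  obtain ⟨h₃, h₄⟩ := one_div_natCast_add_two e.j
  have hcov := WithEyes.old_covBy_old (A := C.eyes) isShort_eyes e.bot_covBy_right
  set δ : ℝ := 1 / (e.i + 2) + 1 / (e.j + 2) with hδ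
  have := h (planeTurn (e.i, e.j + δ)) ?_ ?_
  · simp only [diagram_pos, planeTurn_apply, coord] at this
    linarith
  · refine Or.inr ⟨_, _, hcov, ?_⟩
    rw [diagram_pos, diagram_pos, mem_segment_planeTurn]
    refine ⟨_, ?_, rfl⟩
    refine ⟨1 - δ, δ, by linarith, by linarith, by ring, ?_⟩
    simp only [coord, Cell.bot, Cell.right, point_x, point_y]
    ext <;> simp <;> ring
  · simp only [diagram_pos, planeTurn_apply, coord]
    linarith

/-! #### The corners -/

theorem exists_eq_old_of_not_le {e₀ : C.Grid} (h₁ : ∀ e : C.Cell, ¬e.top ≤ e₀)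
    (h₂ : ∀ e : C.Cell, ¬e₀ ≤ e.bot) {u : C.Lat}
    (hu : u ≤ WithEyes.old e₀ ∨ WithEyes.old e₀ ≤ u) : ∃ g, u = WithEyes.old g := by
  rcases u with g | e
  · exact ⟨g, rfl⟩
  · rcases hu with hu | hu
    · exact absurd (WithEyes.le_old.1 hu) (h₁ e)
    · exact absurd (WithEyes.old_le.1 hu) (h₂ e)

/-- The two hypotheses say that no eye is comparable with `g`, so only old elements occur in a
decomposition. -/
theorem supIrred_old {g : C.Grid} (h₁ : ∀ e : C.Cell, ¬e.top ≤ g)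
    (h₂ : ∀ e : C.Cell, ¬g ≤ e.bot) (hg : SupIrred g) :
    SupIrred (WithEyes.old g : C.Lat) := by
  refine ⟨fun h => hg.1 fun a ha => ?_, ?_⟩
  · exact WithEyes.old_le.1 (h (WithEyes.old_le.2 ha))
  · intro u v huv
    obtain ⟨a, rfl⟩ := exists_eq_old_of_not_le h₁ h₂ (Or.inl (huv ▸ le_sup_left : u ≤ _))
    obtain ⟨b, rfl⟩ := exists_eq_old_of_not_le h₁ h₂ (Or.inl (huv ▸ le_sup_right : v ≤ _))
    simp only [WithEyes.old_sup_old, WithEyes.old.injEq] at huv ⊢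
    exact hg.2 huv

theorem infIrred_old {g : C.Grid} (h₁ : ∀ e : C.Cell, ¬e.top ≤ g)
    (h₂ : ∀ e : C.Cell, ¬g ≤ e.bot) (hg : InfIrred g) :
    InfIrred (WithEyes.old g : C.Lat) := by
  refine ⟨fun h => hg.1 fun a ha => ?_, ?_⟩
  · exact WithEyes.le_old.1 (h (WithEyes.le_old.2 ha))
  · intro u v huv
    obtain ⟨a, rfl⟩ := exists_eq_old_of_not_le h₁ h₂ (Or.inr (huv ▸ inf_le_left : _ ≤ u))
    obtain ⟨b, rfl⟩ := exists_eq_old_of_not_le h₁ h₂ (Or.inr (huv ▸ inf_le_right : _ ≤ v))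
    simp only [WithEyes.old_inf_old, WithEyes.old.injEq] at huv ⊢
    exact hg.2 huv

theorem supIrred_of_old {g : C.Grid} (h : SupIrred (WithEyes.old g : C.Lat)) : SupIrred g := by
  refine ⟨fun hg => h.1 fun u hu => ?_, ?_⟩
  · exact WithEyes.old_le.2
      ((hg (u.lo_le_hi.trans (WithEyes.le_old.1 hu))).trans le_rfl)
  · intro a b hab
    have := h.2 (show (WithEyes.old a ⊔ WithEyes.old b : C.Lat) = _ by
      rw [WithEyes.old_sup_old, hab])
    simpa using this

theorem infIrred_of_old {g : C.Grid} (h : InfIrred (WithEyes.old g : C.Lat)) : InfIrred g := by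
  refine ⟨fun hg => h.1 fun u hu => ?_, ?_⟩
  · exact WithEyes.le_old.2 (hg ((WithEyes.old_le.1 hu).trans u.lo_le_hi))
  · intro a b hab
    have := h.2 (show (WithEyes.old a ⊓ WithEyes.old b : C.Lat) = _ by
      rw [WithEyes.old_inf_old, hab])
    simpa using this

theorem supIrred_leftCorner : SupIrred C.leftCorner := by
  refine ⟨fun h => ?_, ?_⟩
  · have := (h (bot_le (a := C.leftCorner))).1
    have := C.size_pos
    simp only [leftCorner, point_x, Grid.bot_x] at *
    omega
  · intro g h e
    have ex := congrArg Grid.x e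
    have hg : g ≤ C.leftCorner := e ▸ le_sup_left
    have hh : h ≤ C.leftCorner := e ▸ le_sup_right
    have hgy : g.y = 0 := Nat.le_zero.1 hg.2
    have hhy : h.y = 0 := Nat.le_zero.1 hh.2
    rw [Grid.sup_x, hgy, hhy, C.shift_eq_self fun h => absurd h (by simp)] at ex
    rcases max_choice g.x h.x with h₁ | h₁ <;> rw [h₁] at ex
    · exact Or.inl (Grid.ext ex hgy)
    · exact Or.inr (Grid.ext ex hhy)

theorem infIrred_leftCorner : InfIrred C.leftCorner := by
  refine ⟨fun h => ?_, ?_⟩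
  · have := (h (le_top (a := C.leftCorner))).2
    have := C.size_pos
    simp only [leftCorner, point_y, Grid.top_y] at *
    omega
  · intro g h e
    have ey := congrArg Grid.y e
    have hg : C.leftCorner ≤ g := e ▸ inf_le_left
    have hh : C.leftCorner ≤ h := e ▸ inf_le_right
    have hgx : g.x = C.size := g.x_le.antisymm hg.1
    have hhx : h.x = C.size := h.x_le.antisymm hh.1
    rw [Grid.inf_y] at ey
    rcases min_choice g.y h.y with h₁ | h₁ <;> rw [h₁] at ey
    · exact Or.inl (Grid.ext hgx ey)
    · exact Or.inr (Grid.ext hhx ey)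

theorem supIrred_rightCorner : SupIrred C.rightCorner := by
  refine ⟨fun h => ?_, ?_⟩
  · have := (h (bot_le (a := C.rightCorner))).2
    have := C.size_pos
    simp only [rightCorner, point_y, Grid.bot_y] at *
    omega
  · intro g h e
    have ey := congrArg Grid.y e
    have hg : g ≤ C.rightCorner := e ▸ le_sup_left
    have hh : h ≤ C.rightCorner := e ▸ le_sup_right
    have hgx : g.x = 0 := Nat.le_zero.1 hg.1
    have hhx : h.x = 0 := Nat.le_zero.1 hh.1
    rw [Grid.sup_y, hgx, hhx, C.shift_eq_self fun h => absurd h (by simp)] at ey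
    rcases max_choice g.y h.y with h₁ | h₁ <;> rw [h₁] at ey
    · exact Or.inl (Grid.ext hgx ey)
    · exact Or.inr (Grid.ext hhx ey)

theorem infIrred_rightCorner : InfIrred C.rightCorner := by
  refine ⟨fun h => ?_, ?_⟩
  · have := (h (le_top (a := C.rightCorner))).1
    have := C.size_pos
    simp only [rightCorner, point_x, Grid.top_x] at *
    omega
  · intro g h e
    have ex := congrArg Grid.x e
    have hg : C.rightCorner ≤ g := e ▸ inf_le_left
    have hh : C.rightCorner ≤ h := e ▸ inf_le_right
    have hgy : g.y = C.size := g.y_le.antisymm hg.2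
    have hhy : h.y = C.size := h.y_le.antisymm hh.2
    rw [Grid.inf_x] at ex
    rcases min_choice g.x h.x with h₁ | h₁ <;> rw [h₁] at ex
    · exact Or.inl (Grid.ext ex hgy)
    · exact Or.inr (Grid.ext ex hhy)

/-- The only doubly irreducible points of the grid are its left and right corner. -/
theorem eq_corner_of_irred {g : C.Grid} (hs : SupIrred g) (hi : InfIrred g) :
    g = C.leftCorner ∨ g = C.rightCorner := by
  have hx := g.x_le
  have hy := g.y_le
  rcases hx.eq_or_lt with hx | hx <;> rcases hy.eq_or_lt with hy | hy
  · exact absurd (fun u _ => ⟨u.x_le.trans hx.ge, u.y_le.trans hy.ge⟩) hi.1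
  · refine Or.inl (Grid.ext hx ?_)
    by_contra hne
    have h0 : g.y ≠ 0 := hne
    -- A point on the upper left side is the join of the left corner and its neighbour in the same
    -- row.
    let h : C.Grid := ⟨C.size - 1, g.y, by omega, g.y_le, fun _ => g.y_notMem (by omega),
      fun h => absurd h (by omega)⟩
    have e : C.leftCorner ⊔ h = g := by
      apply le_antisymm
      · exact sup_le ⟨hx.ge, zero_le⟩ ⟨by simp only [h]; omega, le_rfl⟩
      · exact ⟨hx.le.trans (Grid.le_def.1 (le_sup_left (a := C.leftCorner) (b := h))).1,
          (Grid.le_def.1 (le_sup_right (a := C.leftCorner) (b := h))).2⟩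
    rcases hs.2 e with e | e
    · exact hne (by rw [← e])
    · have := congrArg Grid.x e
      simp only [h] at this
      omega
  · refine Or.inr (Grid.ext ?_ hy)
    by_contra hne
    have h0 : g.x ≠ 0 := hne
    let h : C.Grid := ⟨g.x, C.size - 1, g.x_le, by omega, fun h => absurd h (by omega),
      fun _ => g.x_notMem (by omega)⟩
    have e : C.rightCorner ⊔ h = g := by
      apply le_antisymm
      · exact sup_le ⟨zero_le, hy.ge⟩ ⟨le_rfl, by simp only [h]; omega⟩
      · exact ⟨(Grid.le_def.1 (le_sup_right (a := C.rightCorner) (b := h))).1,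
          hy.le.trans (Grid.le_def.1 (le_sup_left (a := C.rightCorner) (b := h))).2⟩
    rcases hs.2 e with e | e
    · exact hne (by rw [← e])
    · have := congrArg Grid.y e
      simp only [h] at this
      omega
  · exfalso
    have ha := g.covBy_up_right hx
    have hb := g.covBy_up_left hy
    -- Two different upper covers have meet `g`. They coincide only at a fork point `(f, f)`, which
    -- is the join of `(f, f - 1)` and `(f - 1, f)`.
    by_cases hab : C.up (g.x + 1) g.y hx g.y_le = C.up g.x (g.y + 1) g.x_le hy
    · have ex := congrArg Grid.x hab
      have ey := congrArg Grid.y hab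
      simp only [up_x, up_y] at ex ey
      have hx' := C.le_shift (g.x + 1) g.y
      have hy' := C.le_shift (g.y + 1) g.x
      rcases C.shift_cases g.x (g.y + 1) with ⟨-, mx, -⟩ | ⟨h, -⟩
      swap
      · omega
      rcases C.shift_cases g.y (g.x + 1) with ⟨-, my, -⟩ | ⟨h, -⟩
      swap
      · omega
      have hxy : g.x = g.y := by
        rcases lt_trichotomy g.x g.y with h | h | h
        · exact absurd mx (g.x_notMem h)
        · exact h
        · exact absurd my (g.y_notMem h)
      have h0 : g.x ≠ 0 := fun h => C.zero_notMem (h ▸ mx)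
      have hm : g.x - 1 ∉ C.forks := fun h =>
        C.succ_notMem h (by rwa [Nat.sub_add_cancel (Nat.pos_of_ne_zero h0)])
      let a : C.Grid := ⟨g.x, g.x - 1, g.x_le, by omega, fun _ => hm, fun h => absurd h (by omega)⟩
      let b : C.Grid := ⟨g.x - 1, g.x, by omega, g.x_le, fun h => absurd h (by omega), fun _ => hm⟩
      have e : a ⊔ b = g := by
        apply le_antisymm
        · exact sup_le ⟨le_rfl, by simp only [a]; omega⟩ ⟨by simp only [b]; omega, hxy.le⟩
        · exact ⟨(Grid.le_def.1 (le_sup_left (a := a) (b := b))).1,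
            hxy.ge.trans (Grid.le_def.1 (le_sup_right (a := a) (b := b))).2⟩
      rcases hs.2 e with e | e
      · have := congrArg Grid.y e
        simp only [a] at this
        omega
      · have := congrArg Grid.x e
        simp only [b] at this
        omega
    · have e : C.up (g.x + 1) g.y hx g.y_le ⊓ C.up g.x (g.y + 1) g.x_le hy = g := by
        rcases ha.eq_or_eq (le_inf ha.le hb.le) inf_le_left with h | h
        · exact h
        · exact absurd ((hb.eq_or_eq ha.le (inf_eq_left.1 h)).resolve_left ha.lt.ne') hab
      rcases hi.2 e with e | e
      · exact ha.lt.ne' e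
      · exact hb.lt.ne' e

theorem isLeftCorner_iff (u : C.Lat) :
    C.diagram.IsLeftCorner u ↔ u = WithEyes.old C.leftCorner := by
  constructor
  · rintro ⟨hs, hi, hb⟩
    rcases u with g | e
    · rcases eq_corner_of_irred (supIrred_of_old hs) (infIrred_of_old hi) with rfl | rfl
      · rfl
      · exact absurd hb rightCorner_notMem_leftBoundary
    · exact absurd hb (eye_notMem_leftBoundary e)
  · rintro rfl
    have h₁ : ∀ e : C.Cell, ¬e.top ≤ C.leftCorner := fun e h => absurd h.2 (Nat.not_succ_le_zero _)
    have h₂ : ∀ e : C.Cell, ¬C.leftCorner ≤ e.bot := fun e h => absurd h.1 e.i_lt.not_ge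
    exact ⟨supIrred_old h₁ h₂ supIrred_leftCorner, infIrred_old h₁ h₂ infIrred_leftCorner,
      leftCorner_mem_leftBoundary⟩

theorem isRightCorner_iff (u : C.Lat) :
    C.diagram.IsRightCorner u ↔ u = WithEyes.old C.rightCorner := by
  constructor
  · rintro ⟨hs, hi, hb⟩
    rcases u with g | e
    · rcases eq_corner_of_irred (supIrred_of_old hs) (infIrred_of_old hi) with rfl | rfl
      · exact absurd hb leftCorner_notMem_rightBoundary
      · rfl
    · exact absurd hb (eye_notMem_rightBoundary e)
  · rintro rfl
    have h₁ : ∀ e : C.Cell, ¬e.top ≤ C.rightCorner := fun e h => absurd h.1 (Nat.not_succ_le_zero _)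
    have h₂ : ∀ e : C.Cell, ¬C.rightCorner ≤ e.bot := fun e h => absurd h.2 e.j_lt.not_ge
    exact ⟨supIrred_old h₁ h₂ supIrred_rightCorner, infIrred_old h₁ h₂ infIrred_rightCorner,
      rightCorner_mem_rightBoundary⟩

theorem isCompl_corners :
    IsCompl (WithEyes.old C.leftCorner : C.Lat) (WithEyes.old C.rightCorner) := by
  refine IsCompl.of_eq ?_ ?_
  · rw [WithEyes.old_inf_old, WithEyes.bot_eq]
    exact congrArg _ (Grid.ext (Nat.min_zero _) (Nat.zero_min _))
  · rw [WithEyes.old_sup_old, WithEyes.top_eq]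
    refine congrArg _ (top_le_iff.1 ⟨?_, ?_⟩)
    · exact (Grid.le_def.1 (le_sup_left (a := C.leftCorner) (b := C.rightCorner))).1
    · exact (Grid.le_def.1 (le_sup_right (a := C.leftCorner) (b := C.rightCorner))).2

theorem isRectangularLattice (C : Palette P) : IsRectangularLattice C.Lat :=
  ⟨inferInstance, inferInstance, C.diagram, _, _, isLeftCorner_iff, isRightCorner_iff,
    isCompl_corners⟩

end Palette

/-! ### Congruences of a coloured grid -/

namespace LatticeCon

variable {L : Type*} [Lattice L] (θ : LatticeCon L)

theorem r_of_le_of_le {a b c d : L} (h : θ.r a d) (hab : a ≤ b) (hbc : b ≤ c) (hcd : c ≤ d) :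
    θ.r b c := by
  have h₁ := θ.inf h (θ.refl c)
  rw [inf_eq_left.2 (hab.trans hbc), inf_eq_right.2 hcd] at h₁
  have h₂ := θ.sup h₁ (θ.refl b)
  rwa [sup_eq_right.2 hab, sup_eq_left.2 hbc] at h₂

theorem r_iff_forall_succ {f : ℕ → L} (hf : Monotone f) (a b : ℕ) :
    θ.r (f a) (f b) ↔ ∀ k, min a b ≤ k → k < max a b → θ.r (f k) (f (k + 1)) := by
  wlog hab : a ≤ b generalizing a b
  · rw [min_comm, max_comm, ← this b a (le_of_not_ge hab)]
    exact ⟨θ.symm, θ.symm⟩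
  rw [min_eq_left hab, max_eq_right hab]
  constructor
  · intro h k hak hkb
    exact θ.r_of_le_of_le h (hf hak) (hf k.le_succ) (hf hkb)
  · intro h
    induction b, hab using Nat.le_induction with
    | base => exact θ.refl _
    | succ b hab ih =>
      exact θ.trans (ih fun k h₁ h₂ => h k h₁ (h₂.trans b.lt_succ_self)) (h b hab b.lt_succ_self)

/-- In a sublattice `M₃`, collapsing one of the atoms with the bottom collapses the others, too. -/
theorem r_bot_atom_of_r_bot_atom {o a b c t : L} (hac : a ⊔ c = t) (hbc : b ⊓ c = o)
    (hbt : b ≤ t) (h : θ.r o a) : θ.r o b := by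
  have hoc : o ≤ c := hbc ▸ inf_le_right
  have h₁ := θ.sup h (θ.refl c)
  rw [sup_eq_right.2 hoc, hac] at h₁
  have h₂ := θ.inf (θ.refl b) h₁
  rwa [hbc, inf_eq_left.2 hbt] at h₂

end LatticeCon

namespace Palette

open ForkPattern

variable {P : Type*} [Preorder P] {C : Palette P}

/-! ### The congruence of a lower set of colours -/

/-- All lines between the coordinates `a` and `b` have colours in `I`. -/
def Linked (C : Palette P) (I : LowerSet P) (a b : ℕ) : Prop :=
  ∀ k, min a b ≤ k → k < max a b → C.color k ∈ I

namespace Linked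

variable {I : LowerSet P}

theorem refl (a : ℕ) : C.Linked I a a := fun k h₁ h₂ => by omega

theorem symm {a b : ℕ} (h : C.Linked I a b) : C.Linked I b a :=
  fun k h₁ h₂ => h k (by omega) (by omega)

theorem trans {a b c : ℕ} (h : C.Linked I a b) (h' : C.Linked I b c) : C.Linked I a c := by
  intro k h₁ h₂
  by_cases hk : min a b ≤ k ∧ k < max a b
  · exact h k hk.1 hk.2
  · exact h' k (by omega) (by omega)

theorem min {a b c d : ℕ} (h : C.Linked I a b) (h' : C.Linked I c d) :
    C.Linked I (min a c) (min b d) := by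
  intro k h₁ h₂
  by_cases hk : Min.min a b ≤ k ∧ k < max a b
  · exact h k hk.1 hk.2
  · exact h' k (by omega) (by omega)

theorem max {a b c d : ℕ} (h : C.Linked I a b) (h' : C.Linked I c d) :
    C.Linked I (max a c) (max b d) := by
  intro k h₁ h₂
  by_cases hk : Min.min a b ≤ k ∧ k < Max.max a b
  · exact h k hk.1 hk.2
  · exact h' k (by omega) (by omega)

theorem succ {a : ℕ} (h : C.color a ∈ I) : C.Linked I a (a + 1) := by
  intro k h₁ h₂
  obtain rfl : k = a := by omega
  exact h

/-- One of the two lines next to `f` is collapsed. If it is line `f - 1`, the fork condition and the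
lower set `I` pass this on to line `f`. -/
theorem color_mem_of_ne {f a : ℕ} (h : C.Linked I f a) (hf : f ∈ C.forks) (hne : f ≠ a) :
    C.color f ∈ I := by
  rcases hne.lt_or_gt with hlt | hlt
  · exact h f (by omega) (by omega)
  · exact I.lower (C.color_le hf) (h (f - 1) (by omega) (by omega))

theorem shift_of_color {a : ℕ} (h : a ∈ C.forks → C.color a ∈ I) (b : ℕ) :
    C.Linked I a (C.shift a b) := by
  rcases C.shift_cases a b with ⟨e, ha, -⟩ | ⟨e, -⟩ <;> rw [e]
  · exact succ (h ha)
  · exact refl a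

/-- This is compatibility with joins. A shift across a collapsed line is harmless. If `a = b` is a
fork whose line is not collapsed, that line cannot separate `c` from `d`, so both shift `a` alike.
-/
theorem shift {a b c d : ℕ} (h : C.Linked I a b) (h' : C.Linked I c d) :
    C.Linked I (C.shift a c) (C.shift b d) := by
  by_cases hab : a = b
  · subst hab
    by_cases ha : a ∈ C.forks → C.color a ∈ I
    · exact (shift_of_color ha c).symm.trans (shift_of_color ha d)
    · push Not at ha
      have hcd : a < c ↔ a < d := by
        by_contra hne
        exact ha.2 (h' a (by omega) (by omega))
      have : C.shift a c = C.shift a d := by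
        by_cases hac : a < c
        · rw [C.shift_eq_succ ha.1 hac, C.shift_eq_succ ha.1 (hcd.1 hac)]
        · rw [C.shift_eq_self fun h => absurd h hac, C.shift_eq_self fun h => absurd (hcd.2 h) hac]
      rw [this]
      exact refl _
  · exact (shift_of_color (fun ha => h.color_mem_of_ne ha hab) c).symm.trans
      (h.trans (shift_of_color (fun hb => h.symm.color_mem_of_ne hb (Ne.symm hab)) d))

end Linked

/-- The congruence of the grid that collapses the lines with colours in `I`. -/
noncomputable def gridCon (C : Palette P) (I : LowerSet P) : LatticeCon C.Grid where
  r g h := C.Linked I g.x h.x ∧ C.Linked I g.y h.y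
  iseqv :=
    { refl := fun _ => ⟨Linked.refl _, Linked.refl _⟩
      symm := fun h => ⟨h.1.symm, h.2.symm⟩
      trans := fun h k => ⟨h.1.trans k.1, h.2.trans k.2⟩ }
  inf h k := ⟨h.1.min k.1, h.2.min k.2⟩
  sup h k := ⟨(h.1.max k.1).shift (h.2.max k.2), (h.2.max k.2).shift (h.1.max k.1)⟩

theorem gridCon_iff {I : LowerSet P} {g h : C.Grid} :
    (C.gridCon I).r g h ↔ C.Linked I g.x h.x ∧ C.Linked I g.y h.y := Iff.rfl

theorem gridCon_bot_top {I : LowerSet P} {e : C.Cell} :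
    (C.gridCon I).r e.bot e.top ↔ C.color e.i ∈ I := by
  constructor
  · intro h
    exact h.1 e.i (by simp [Cell.bot, Cell.top]) (by simp [Cell.bot, Cell.top])
  · intro h
    exact ⟨Linked.succ h, Linked.succ (e.color_eq ▸ h)⟩

/-- The congruence that collapses the lines with colours in `I`. -/
noncomputable def con (C : Palette P) (I : LowerSet P) : LatticeCon C.Lat :=
  WithEyes.extendCon (C.gridCon I) fun e => by
    by_cases h : C.color e.i ∈ I
    · exact Or.inl (gridCon_bot_top.2 h)
    have h' : C.color e.j ∉ I := e.color_eq ▸ h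
    -- The uncollapsed lines `i` and `j` separate the top of the cell from every point with a
    -- smaller coordinate, and the bottom from every point with a larger one.
    refine Or.inr ⟨fun s hs => ⟨?_, ?_⟩, fun s hs => ⟨?_, ?_⟩⟩
    · by_contra! hlt
      simp only [eyes_hi, Cell.top, point_x] at hlt
      exact h (hs.1 e.i (by simp only [eyes_hi, Cell.top, point_x]; omega)
        (by simp only [eyes_hi, Cell.top, point_x]; omega))
    · by_contra! hlt
      simp only [eyes_hi, Cell.top, point_y] at hlt
      exact h' (hs.2 e.j (by simp only [eyes_hi, Cell.top, point_y]; omega)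
        (by simp only [eyes_hi, Cell.top, point_y]; omega))
    · by_contra! hlt
      simp only [eyes_lo, Cell.bot, point_x] at hlt
      exact h (hs.1 e.i (by simp only [eyes_lo, Cell.bot, point_x]; omega)
        (by simp only [eyes_lo, Cell.bot, point_x]; omega))
    · by_contra! hlt
      simp only [eyes_lo, Cell.bot, point_y] at hlt
      exact h' (hs.2 e.j (by simp only [eyes_lo, Cell.bot, point_y]; omega)
        (by simp only [eyes_lo, Cell.bot, point_y]; omega))

/-- The points of the lower left side. -/
def base (C : Palette P) (k : ℕ) : C.Grid :=
  C.point (min k C.size) 0 (min_le_right _ _) zero_le (Or.inr zero_le)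

/-- The points of the lower right side. -/
def side (C : Palette P) (k : ℕ) : C.Grid :=
  C.point 0 (min k C.size) zero_le (min_le_right _ _) (Or.inl zero_le)

@[simp] theorem base_x (k : ℕ) : (C.base k).x = min k C.size := rfl
@[simp] theorem base_y (k : ℕ) : (C.base k).y = 0 := rfl
@[simp] theorem side_x (k : ℕ) : (C.side k).x = 0 := rfl
@[simp] theorem side_y (k : ℕ) : (C.side k).y = min k C.size := rfl

theorem base_sup_side (g : C.Grid) : C.base g.x ⊔ C.side g.y = g := by
  have hx := g.x_le
  have hy := g.y_le
  refine Grid.ext ?_ ?_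
  · rw [Grid.sup_x]
    simp only [base_x, base_y, side_x, side_y, min_eq_left hx, min_eq_left hy, Nat.max_zero,
      Nat.zero_max]
    exact C.shift_eq_self g.x_notMem
  · rw [Grid.sup_y]
    simp only [base_x, base_y, side_x, side_y, min_eq_left hx, min_eq_left hy, Nat.max_zero,
      Nat.zero_max]
    exact C.shift_eq_self g.y_notMem

theorem inf_leftCorner (g : C.Grid) : g ⊓ C.leftCorner = C.base g.x := Grid.ext rfl (Nat.min_zero _)

theorem inf_rightCorner (g : C.Grid) : g ⊓ C.rightCorner = C.side g.y :=
  Grid.ext (Nat.min_zero _) rfl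

/-- The points of the lower left side, as elements of the lattice. -/
def baseElt (C : Palette P) (k : ℕ) : C.Lat := WithEyes.old (C.base k)

/-- The points of the lower right side, as elements of the lattice. -/
def sideElt (C : Palette P) (k : ℕ) : C.Lat := WithEyes.old (C.side k)

theorem baseElt_monotone : Monotone C.baseElt := fun _ _ h =>
  WithEyes.old_le.2 ⟨min_le_min_right _ h, le_rfl⟩

theorem sideElt_monotone : Monotone C.sideElt := fun _ _ h =>
  WithEyes.old_le.2 ⟨le_rfl, min_le_min_right _ h⟩

/-! ### The colours collapsed by an arbitrary congruence -/

variable (θ : LatticeCon C.Lat)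

/-- Meets with the two corners project the grid to its lower sides, and a point is the join of its
projections. -/
theorem r_old_iff {g h : C.Grid} :
    θ.r (WithEyes.old g) (WithEyes.old h) ↔
      θ.r (C.baseElt g.x) (C.baseElt h.x) ∧ θ.r (C.sideElt g.y) (C.sideElt h.y) := by
  constructor
  · intro hr
    have h₁ := θ.inf hr (θ.refl (WithEyes.old C.leftCorner))
    have h₂ := θ.inf hr (θ.refl (WithEyes.old C.rightCorner))
    rw [WithEyes.old_inf_old, WithEyes.old_inf_old, inf_leftCorner, inf_leftCorner] at h₁
    rw [WithEyes.old_inf_old, WithEyes.old_inf_old, inf_rightCorner, inf_rightCorner] at h₂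
    exact ⟨h₁, h₂⟩
  · rintro ⟨h₁, h₂⟩
    have := θ.sup h₁ h₂
    rwa [baseElt, baseElt, sideElt, sideElt, WithEyes.old_sup_old, WithEyes.old_sup_old,
      base_sup_side, base_sup_side] at this

theorem r_bot_left_iff (e : C.Cell) :
    θ.r (WithEyes.old e.bot) (WithEyes.old e.left) ↔
      θ.r (C.baseElt e.i) (C.baseElt (e.i + 1)) := by
  rw [r_old_iff]
  exact and_iff_left (θ.refl _)

theorem r_bot_right_iff (e : C.Cell) :
    θ.r (WithEyes.old e.bot) (WithEyes.old e.right) ↔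
      θ.r (C.sideElt e.j) (C.sideElt (e.j + 1)) := by
  rw [r_old_iff]
  exact and_iff_right (θ.refl _)

theorem Cell.left_sup_right (e : C.Cell) : e.left ⊔ e.right = e.top := by
  apply le_antisymm
  · exact sup_le e.left_covBy_top.le e.right_covBy_top.le
  · exact ⟨(Grid.le_def.1 (le_sup_left (a := e.left) (b := e.right))).1,
      (Grid.le_def.1 (le_sup_right (a := e.left) (b := e.right))).2⟩

theorem Cell.left_inf_right (e : C.Cell) : e.left ⊓ e.right = e.bot :=
  Grid.ext (min_eq_right (Nat.le_succ _)) (min_eq_left (Nat.le_succ _))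

theorem Cell.old_sup_eye (e : C.Cell) {g : C.Grid} (h₁ : e.bot ⋖ g) (h₂ : g ⋖ e.top) :
    (WithEyes.old g ⊔ WithEyes.eye e : C.Lat) = WithEyes.old e.top := by
  rw [WithEyes.sup_eq_of_not_le, WithEyes.hi_old, WithEyes.hi_eye, eyes_hi, sup_eq_right.2 h₂.le]
  · exact fun h => h₁.lt.not_ge (WithEyes.old_le.1 h)
  · exact fun h => h₂.lt.not_ge (WithEyes.le_old.1 h)

theorem Cell.old_inf_eye (e : C.Cell) {g : C.Grid} (h₁ : e.bot ⋖ g) (h₂ : g ⋖ e.top) :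
    (WithEyes.old g ⊓ WithEyes.eye e : C.Lat) = WithEyes.old e.bot := by
  rw [WithEyes.inf_eq_of_not_le, WithEyes.lo_old, WithEyes.lo_eye, eyes_lo, inf_eq_right.2 h₁.le]
  · exact fun h => h₁.lt.not_ge (WithEyes.old_le.1 h)
  · exact fun h => h₂.lt.not_ge (WithEyes.le_old.1 h)

theorem r_base_iff_r_side (e : C.Cell) :
    θ.r (C.baseElt e.i) (C.baseElt (e.i + 1)) ↔ θ.r (C.sideElt e.j) (C.sideElt (e.j + 1)) := by
  rw [← r_bot_left_iff, ← r_bot_right_iff]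
  constructor
  · exact θ.r_bot_atom_of_r_bot_atom (e.old_sup_eye e.bot_covBy_left e.left_covBy_top)
      (e.old_inf_eye e.bot_covBy_right e.right_covBy_top)
      (WithEyes.old_le.2 e.right_covBy_top.le)
  · exact θ.r_bot_atom_of_r_bot_atom (e.old_sup_eye e.bot_covBy_right e.right_covBy_top)
      (e.old_inf_eye e.bot_covBy_left e.left_covBy_top)
      (WithEyes.old_le.2 e.left_covBy_top.le)

theorem r_bot_eye_iff (e : C.Cell) :
    θ.r (WithEyes.old e.bot) (WithEyes.eye e) ↔ θ.r (C.baseElt e.i) (C.baseElt (e.i + 1)) := by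
  have hl : (WithEyes.old e.left ⊓ WithEyes.old e.right : C.Lat) = WithEyes.old e.bot := by
    rw [WithEyes.old_inf_old, e.left_inf_right]
  have hs : (WithEyes.old e.left ⊔ WithEyes.old e.right : C.Lat) = WithEyes.old e.top := by
    rw [WithEyes.old_sup_old, e.left_sup_right]
  constructor
  · intro h
    rw [← r_bot_left_iff]
    refine θ.r_bot_atom_of_r_bot_atom (c := WithEyes.old e.right) (t := WithEyes.old e.top) ?_ hl
      (WithEyes.old_le.2 e.left_covBy_top.le) h
    rw [sup_comm]
    exact e.old_sup_eye e.bot_covBy_right e.right_covBy_top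
  · intro h
    rw [← r_bot_left_iff] at h
    refine θ.r_bot_atom_of_r_bot_atom hs ?_ (WithEyes.eye_covBy_hi e).le h
    rw [inf_comm]
    exact e.old_inf_eye e.bot_covBy_right e.right_covBy_top

/-- Lines of the same colour are collapsed simultaneously. -/
theorem r_base_iff_of_color_eq {k l : ℕ} (hk : k < C.size) (hl : l < C.size)
    (h : C.color k = C.color l) :
    (θ.r (C.baseElt k) (C.baseElt (k + 1)) ↔ θ.r (C.baseElt l) (C.baseElt (l + 1))) ∧
      (θ.r (C.sideElt k) (C.sideElt (k + 1)) ↔ θ.r (C.baseElt l) (C.baseElt (l + 1))) := by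
  -- A free line `m` of the same colour serves as a hub: the cells `(k, m)`, `(l, m)`, `(m, m)` and
  -- `(m, k)` all have eyes.
  obtain ⟨m, hm, hmc⟩ := C.exists_color (C.color k)
  have hm' := hm.trans_le C.free_le_size
  have h₁ := r_base_iff_r_side θ ⟨k, m, hk, hm', Or.inr hm, hmc.symm⟩
  have h₂ := r_base_iff_r_side θ ⟨l, m, hl, hm', Or.inr hm, h.symm.trans hmc.symm⟩
  have h₃ := r_base_iff_r_side θ ⟨m, m, hm', hm', Or.inr hm, rfl⟩
  have h₄ := r_base_iff_r_side θ ⟨m, k, hm', hk, Or.inl hm, hmc⟩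
  simp only at h₁ h₂ h₃ h₄
  tauto

/-- Joining with `(0, f + 1)` sends `(f - 1, 0)` to `(f - 1, f + 1)`, but `(f, 0)` to `(f + 1, f +
1)`, as `(f, f + 1)` is missing. Meeting with `(f + 1, 0)` shows that line `f` is collapsed as well.
-/
theorem r_base_of_fork {f : ℕ} (hf : f ∈ C.forks)
    (h : θ.r (C.baseElt (f - 1)) (C.baseElt f)) : θ.r (C.baseElt f) (C.baseElt (f + 1)) := by
  have hlt := C.lt_size hf
  have h0 : f ≠ 0 := fun h => C.zero_notMem (h ▸ hf)
  have hf' : f - 1 ∉ C.forks := fun h =>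
    C.succ_notMem h (by rwa [Nat.sub_add_cancel (Nat.pos_of_ne_zero h0)])
  have h₁ := θ.inf (θ.sup h (θ.refl (C.sideElt (f + 1)))) (θ.refl (C.baseElt (f + 1)))
  simp only [baseElt, sideElt, WithEyes.old_sup_old, WithEyes.old_inf_old] at h₁
  have e₁ : (C.base (f - 1) ⊔ C.side (f + 1)) ⊓ C.base (f + 1) = C.base (f - 1) := by
    refine Grid.ext ?_ (Nat.min_zero _)
    rw [Grid.inf_x, Grid.sup_x]
    simp only [base_x, base_y, side_x, side_y, Nat.max_zero, Nat.zero_max]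
    rw [min_eq_left (by omega : f - 1 ≤ C.size), C.shift_eq_self fun _ => hf']
    omega
  have e₂ : (C.base f ⊔ C.side (f + 1)) ⊓ C.base (f + 1) = C.base (f + 1) := by
    refine Grid.ext ?_ (Nat.min_zero _)
    rw [Grid.inf_x, Grid.sup_x]
    simp only [base_x, base_y, side_x, side_y, Nat.max_zero, Nat.zero_max]
    rw [min_eq_left hlt.le, C.shift_eq_succ hf (by omega)]
    omega
  rw [e₁, e₂] at h₁
  exact θ.r_of_le_of_le h₁ (baseElt_monotone (Nat.sub_le _ _)) (baseElt_monotone f.le_succ) le_rfl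

/-- The colours of the lines that are collapsed by a congruence. -/
def colors (θ : LatticeCon C.Lat) : LowerSet P where
  carrier := {p | ∃ k < C.size, C.color k = p ∧ θ.r (C.baseElt k) (C.baseElt (k + 1))}
  lower' := by
    rintro q p hpq ⟨k, hk, rfl, h⟩
    obtain ⟨f, hf, hq, rfl⟩ := C.exists_fork hpq
    have hlt := C.lt_size hf
    have h0 : f ≠ 0 := fun h => C.zero_notMem (h ▸ hf)
    refine ⟨f, hlt, rfl, r_base_of_fork θ hf ?_⟩
    have := ((r_base_iff_of_color_eq θ hk (show f - 1 < C.size by omega) hq.symm).1).1 h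
    rwa [Nat.sub_add_cancel (Nat.pos_of_ne_zero h0)] at this

theorem color_mem_colors_iff {k : ℕ} (hk : k < C.size) :
    C.color k ∈ colors θ ↔ θ.r (C.baseElt k) (C.baseElt (k + 1)) := by
  constructor
  · rintro ⟨l, hl, hc, h⟩
    exact ((r_base_iff_of_color_eq θ hl hk hc).1).1 h
  · intro h
    exact ⟨k, hk, rfl, h⟩

theorem color_mem_colors_iff' {k : ℕ} (hk : k < C.size) :
    C.color k ∈ colors θ ↔ θ.r (C.sideElt k) (C.sideElt (k + 1)) :=
  (color_mem_colors_iff θ hk).trans (r_base_iff_of_color_eq θ hk hk rfl).2.symm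

theorem gridCon_colors_iff {g h : C.Grid} :
    (C.gridCon (colors θ)).r g h ↔ θ.r (WithEyes.old g) (WithEyes.old h) := by
  rw [r_old_iff, θ.r_iff_forall_succ baseElt_monotone, θ.r_iff_forall_succ sideElt_monotone,
    gridCon_iff]
  have h₁ := g.x_le
  have h₂ := g.y_le
  have h₃ := h.x_le
  have h₄ := h.y_le
  refine and_congr ?_ ?_
  · exact forall₃_congr fun k _ _ => color_mem_colors_iff θ (by omega)
  · exact forall₃_congr fun k _ _ => color_mem_colors_iff' θ (by omega)

theorem r_lo_of_gridCon {u : C.Lat} (h : (C.gridCon (colors θ)).r u.lo u.hi) :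
    θ.r (WithEyes.old u.lo) u := by
  rcases u with g | e
  · exact θ.refl _
  · exact (r_bot_eye_iff θ e).2 ((color_mem_colors_iff θ e.i_lt).1 (gridCon_bot_top.1 h))

/-- An eye below `v ≠ u` is congruent to the top of its cell; an eye not below `v` is congruent to a
meet that lies under the bottom of its cell. Either way its cell is collapsed. -/
theorem gridCon_of_r_of_ne {u v : C.Lat} (h : θ.r u v) (hne : u ≠ v) :
    (C.gridCon (colors θ)).r u.lo u.hi := by
  rcases u with g | e
  · exact (C.gridCon _).refl _
  refine gridCon_bot_top.2 ((color_mem_colors_iff θ e.i_lt).2 ?_)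
  rw [← r_bot_eye_iff]
  by_cases hle : WithEyes.eye e ≤ v
  · have hv : e.top ≤ v.lo := hle.resolve_left hne
    have h₁ := θ.r_of_le_of_le h le_rfl (WithEyes.eye_covBy_hi e).le (WithEyes.old_le.2 hv)
    have h₂ := θ.inf h₁ (θ.refl (WithEyes.old e.left))
    have hl : (WithEyes.old e.left : C.Lat) ≤ WithEyes.old e.top :=
      WithEyes.old_le.2 e.left_covBy_top.le
    rw [inf_comm, e.old_inf_eye e.bot_covBy_left e.left_covBy_top, eyes_hi, inf_eq_right.2 hl,
      r_bot_left_iff] at h₂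
    exact (r_bot_eye_iff θ e).2 h₂
  · have h₁ := θ.inf (θ.refl (WithEyes.eye e)) h
    rw [inf_idem] at h₁
    rcases (inf_le_left : WithEyes.eye e ⊓ v ≤ _) with h₂ | h₂
    · exact absurd (inf_eq_left.1 h₂) hle
    · exact θ.r_of_le_of_le (θ.symm h₁) (WithEyes.le_old.2 h₂) (WithEyes.lo_covBy_eye e).le le_rfl

/-- The two congruences agree on the grid. For both, an eye that is not alone in its class is
congruent to the bottom of its cell and can be replaced by it. -/
theorem con_colors : C.con (colors θ) = θ := by
  apply le_antisymm
  · rintro u v (rfl | ⟨hu, hv, h⟩)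
    · exact θ.refl _
    · exact θ.trans (θ.symm (r_lo_of_gridCon θ hu))
        (θ.trans ((gridCon_colors_iff θ).1 h) (r_lo_of_gridCon θ hv))
  · intro u v h
    by_cases hne : u = v
    · exact Or.inl hne
    have hu := gridCon_of_r_of_ne θ h hne
    have hv := gridCon_of_r_of_ne θ (θ.symm h) (Ne.symm hne)
    exact Or.inr ⟨hu, hv, (gridCon_colors_iff θ).2
      (θ.trans (r_lo_of_gridCon θ hu) (θ.trans h (θ.symm (r_lo_of_gridCon θ hv))))⟩

theorem con_le_con_iff {I J : LowerSet P} : C.con I ≤ C.con J ↔ I ≤ J := by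
  constructor
  · intro h p hp
    obtain ⟨k, hk, rfl⟩ := C.exists_color p
    have hk' := hk.trans_le C.free_le_size
    have hI : (C.con I).r (C.baseElt k) (C.baseElt (k + 1)) := by
      refine Or.inr ⟨(C.gridCon I).refl _, (C.gridCon I).refl _, ?_, Linked.refl _⟩
      intro m h₁ h₂
      simp only [baseElt, WithEyes.lo_old, base_x] at h₁ h₂
      obtain rfl : m = k := by omega
      exact hp
    rcases h hI with h' | ⟨-, -, h', -⟩
    · have : min k C.size = min (k + 1) C.size :=
        congrArg Grid.x (WithEyes.old.inj h')
      omega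
    · exact h' k (by simp only [baseElt, WithEyes.lo_old, base_x]; omega)
        (by simp only [baseElt, WithEyes.lo_old, base_x]; omega)
  · intro h u v
    have key : ∀ {g g' : C.Grid}, (C.gridCon I).r g g' → (C.gridCon J).r g g' := fun hg =>
      ⟨fun k h₁ h₂ => h (hg.1 k h₁ h₂), fun k h₁ h₂ => h (hg.2 k h₁ h₂)⟩
    rintro (rfl | ⟨hu, hv, h'⟩)
    · exact Or.inl rfl
    · exact Or.inr ⟨key hu, key hv, key h'⟩

/-- The congruence lattice is the lattice of lower sets of the set of colours. -/
noncomputable def lowerSetIso (C : Palette P) : LowerSet P ≃o LatticeCon C.Lat :=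
  RelIso.ofSurjective (OrderEmbedding.ofMapLEIff C.con fun _ _ => con_le_con_iff)
    fun θ => ⟨colors θ, con_colors θ⟩

end Palette

/-! ### Every finite preordered set colours a forked grid -/

theorem Finite.exists_nat_enumeration (α : Type*) [Finite α] [Nonempty α] :
    ∃ (n : ℕ) (f : ℕ → α), ∀ a, ∃ k < n, f k = a := by
  obtain ⟨n, ⟨e⟩⟩ := Finite.exists_equiv_fin α
  refine ⟨n, fun k => if h : k < n then e.symm ⟨k, h⟩ else Classical.arbitrary α, fun a => ?_⟩
  exact ⟨e a, (e a).2, by simp⟩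

theorem Palette.nonempty (P : Type*) [Preorder P] [Finite P] [Nonempty P] :
    Nonempty (Palette P) := by
  obtain ⟨n, c, hc⟩ := Finite.exists_nat_enumeration P
  obtain ⟨m, d, hd⟩ := Finite.exists_nat_enumeration (P × P)
  have hn : 0 < n := by
    obtain ⟨k, hk, -⟩ := hc (Classical.arbitrary P)
    omega
  -- The `n` free lines list `P`. Then the `k`-th pair takes lines `n + 2 * k` (second component)
  -- and `n + 2 * k + 1` (first component), with a fork at the latter only if first `≤` second. This
  -- spacing keeps forks non-adjacent and beyond `n`.
  let color : ℕ → P := fun k =>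
    if k < n then c k else if (k - n) % 2 = 0 then (d ((k - n) / 2)).2 else (d ((k - n) / 2)).1
  have h_even : ∀ k, color (n + 2 * k) = (d k).2 := by
    intro k
    have h₁ : ¬n + 2 * k < n := by omega
    have h₂ : (n + 2 * k - n) % 2 = 0 := by omega
    have h₃ : (n + 2 * k - n) / 2 = k := by omega
    simp only [color, h₁, h₂, h₃, if_true, if_false]
  have h_odd : ∀ k, color (n + 2 * k + 1) = (d k).1 := by
    intro k
    have h₁ : ¬n + 2 * k + 1 < n := by omega
    have h₂ : ¬(n + 2 * k + 1 - n) % 2 = 0 := by omega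
    have h₃ : (n + 2 * k + 1 - n) / 2 = k := by omega
    simp only [color, h₁, h₂, h₃, if_false]
  exact ⟨
    { size := n + 2 * m
      forks := {f | ∃ k < m, f = n + 2 * k + 1 ∧ (d k).1 ≤ (d k).2}
      lt_size := by
        rintro f ⟨k, hk, rfl, -⟩
        omega
      succ_notMem := by
        rintro f ⟨k, hk, rfl, -⟩ ⟨l, hl, h, -⟩
        omega
      zero_notMem := by
        rintro ⟨k, hk, h, -⟩
        omega
      color := color
      free := n
      free_pos := hn
      free_le_size := by omega
      free_lt := by
        rintro f ⟨k, hk, rfl, -⟩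
        omega
      exists_color := by
        intro p
        obtain ⟨k, hk, rfl⟩ := hc p
        exact ⟨k, hk, if_pos hk⟩
      color_le := by
        rintro f ⟨k, hk, rfl, h⟩
        rwa [Nat.add_sub_cancel, h_even, h_odd]
      exists_fork := by
        intro p q hpq
        obtain ⟨k, hk, hdk⟩ := hd (p, q)
        refine ⟨n + 2 * k + 1, ⟨k, hk, rfl, by rwa [hdk]⟩, ?_, ?_⟩
        · rw [Nat.add_sub_cancel, h_even, hdk]
        · rw [h_odd, hdk] }⟩

theorem theorem2 {D : Type*} [DistribLattice D] [Finite D] [Nontrivial D] :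
    ∃ (K : Type) (_ : Lattice K) (_ : BoundedOrder K),
      IsRectangularLattice K ∧ Nonempty (D ≃o LatticeCon K) := by
  have := Fintype.ofFinite D
  classical
  let := Fintype.toBoundedOrder D
  -- A palette needs at least one colour; without join-irreducible elements `D` would be trivial.
  have : Nonempty {a : D // SupIrred a} := by
    by_contra hne
    rw [not_nonempty_iff] at hne
    have : Subsingleton (LowerSet {a : D // SupIrred a}) :=
      ⟨fun _ _ => SetLike.ext fun a => isEmptyElim a⟩
    have hsub : Subsingleton D := OrderIso.lowerSetSupIrred.toEquiv.injective.subsingleton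
    exact not_subsingleton D hsub
  obtain ⟨C⟩ := Palette.nonempty {a : D // SupIrred a}
  exact ⟨C.Lat, inferInstance, inferInstance, C.isRectangularLattice,
    ⟨OrderIso.lowerSetSupIrred.trans C.lowerSetIso⟩⟩
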